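/- Let $\mathbb{F}_q$ be a finite field and let $R = M_{3\times 3}(\mathbb{F}_q)$. Let $w : R \to \mathbb{Z}_{\ge 0}$ be a weight with $w(0)=0$, with $w(r)>0$ for all $r \neq 0$, and with maximal symmetry: $w(ur) = w(ru) = w(r)$ for all $r \in R$ and all units $u$ of $R$. Then $w(r)$ depends only on the rank of $r$; write $w_i$ for its value on matrices of rank $i$ ($0 \le i \le 3$). Call $w$ \emph{nondegenerate} if \[ c_j = (-1)^j q^{\binom{j}{2}} \sum_{\ell=0}^{j} (-1)^\ell q^{\binom{\ell}{2}} \genfrac{[}{]}{0pt}{}{j}{\ell}_q\, w_\ell \neq 0 \quad \text{for } j = 1,2,3, \] where $\genfrac{[}{]}{0pt}{}{j}{\ell}_q$ is the $q$-binomial coefficient, and \emph{degenerate} otherwise; in particular $c_2 = q\bigl(-(q+1)w_1 + q w_2\bigr)$. Extend $w$ to $R^n$ by $w(x) = \sum_i w(x_i)$, let $w_{\max}$ be the largest value of $w$ on $R$, and for $C \subseteq R^n$ put $\mathrm{wwe}_C(X,Y) = \sum_{x \in C} X^{n w_{\max} - w(x)} Y^{w(x)}$ and $\mathcal{R}(C)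 = \{ y \in R^n : \sum_i x_i y_i = 0 \text{ for all } x \in C \}$. The weight $w$ \emph{respects duality} if, for every $n \ge 1$ and all left $R$-submodules $C, D \subseteq R^n$, $\mathrm{wwe}_C = \mathrm{wwe}_D$ implies $\mathrm{wwe}_{\mathcal{R}(C)} = \mathrm{wwe}_{\mathcal{R}(D)}$. Theorem. (1) If $w$ is nondegenerate and not a multiple of the Hamming weight (which is $0$ at $0$ and $1$ at every nonzero element of $R$), then $w$ does not respect duality. (2) If $w$ is degenerate because $-(q+1)w_1 + q w_2 = 0$, then $w$ does not respect duality. -/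

import Mathlib

namespace WeightDuality

section Weights

variable {R : Type*} [Ring R]

/-- A weight has maximal symmetry when its left and right symmetry groups both equal the full
group of units of the ring. -/
def MaximalSymmetry (w : R → ℕ) : Prop :=
  (∀ (u : Rˣ) (r : R), w (u * r) = w r) ∧ (∀ (u : Rˣ) (r : R), w (r * u) = w r)

open Classical in
/-- The Hamming weight on `R`. -/
noncomputable def hammingWeight (r : R) : ℕ := if r = 0 then 0 else 1

/-- `w` is a multiple of the Hamming weight. -/
def IsMultipleOfHamming (w : R → ℕ) : Prop := ∃ c : ℕ, ∀ r : R, w r = c * hammingWeight r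

/-- The additive extension of a weight to `R ^ n`. -/
def vecWeight (w : R → ℕ) {n : ℕ} (x : Fin n → R) : ℕ := ∑ i, w (x i)

/-- The right dual code `{y | x ⬝ y = 0 for all x ∈ C}` with respect to the standard dot product
`x ⬝ y = ∑ i, x i * y i`. -/
def rightDual {n : ℕ} (C : Set (Fin n → R)) : Set (Fin n → R) :=
  {y | ∀ x ∈ C, ∑ i, x i * y i = 0}

/-- The largest value of a weight on a finite ring. -/
def maxWeight [Fintype R] (w : R → ℕ) : ℕ := Finset.univ.sup w

open Classical in
/-- The homogeneous weight enumerator `∑ x ∈ C, X ^ (n * w_max - w x) * Y ^ (w x)` of a code `C` of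
length `n`, with `X = X 0` and `Y = X 1`. -/
noncomputable def weightEnumerator [Fintype R] (w : R → ℕ) {n : ℕ} (C : Set (Fin n → R)) :
    MvPolynomial (Fin 2) ℂ :=
  ∑ x : Fin n → R with x ∈ C,
    MvPolynomial.X 0 ^ (n * maxWeight w - vecWeight w x) * MvPolynomial.X 1 ^ vecWeight w x

/-- `w` respects duality: left `R`-linear codes of the same length `n ≥ 1` with equal
`w`-weight enumerators have right dual codes with equal `w`-weight enumerators. -/
def RespectsDuality [Fintype R] (w : R → ℕ) : Prop :=
  ∀ n : ℕ, 1 ≤ n → ∀ C D : Submodule R (Fin n → R),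
    weightEnumerator w (C : Set (Fin n → R)) = weightEnumerator w (D : Set (Fin n → R)) →
      weightEnumerator w (rightDual (C : Set (Fin n → R))) =
        weightEnumerator w (rightDual (D : Set (Fin n → R)))

end Weights

/-- The `q`-binomial coefficient `(q^m-1)⋯(q^(m-j+1)-1) / ((q^j-1)⋯(q-1))` for `q ≥ 2`.
It is `1` for `j = 0`, and for `j > m` the factor with `i = m` makes it `0`. -/
def qBinomial (q m j : ℕ) : ℚ :=
  (∏ i ∈ Finset.range j, ((q : ℚ) ^ (m - i) - 1)) / ∏ i ∈ Finset.range j, ((q : ℚ) ^ (i + 1) - 1)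

section Matrices

variable {F : Type*} [Field F] {k : ℕ}

/-- The standard `k × k` matrix of rank `i` (for `i ≤ k`): an `i × i` identity block in the upper
left corner, and zeros elsewhere. -/
def rankMatrix (F : Type*) [Field F] (k i : ℕ) : Matrix (Fin k) (Fin k) F :=
  Matrix.diagonal fun j => if (j : ℕ) < i then 1 else 0

/-- The value `w_i` of `w` on the standard matrix of rank `i`; for a weight with maximal symmetry it
is the common value of `w` on all matrices of rank `i`. -/
def rankWeight (w : Matrix (Fin k) (Fin k) F → ℕ) (i : ℕ) : ℕ := w (rankMatrix F k i)

/-- The expressions `c_j = (-1)^j q^(j choose 2) ∑_{ℓ=0}^{j} (-1)^ℓ q^(ℓ choose 2) [j ℓ]_q w_ℓ`,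
where `q = |F|`. -/
def degeneracyCoeff [Fintype F] (w : Matrix (Fin k) (Fin k) F → ℕ) (j : ℕ) : ℚ :=
  (-1) ^ j * (Fintype.card F : ℚ) ^ j.choose 2 *
    ∑ l ∈ Finset.range (j + 1),
      (-1) ^ l * (Fintype.card F : ℚ) ^ l.choose 2 * qBinomial (Fintype.card F) j l *
        (rankWeight w l : ℚ)

/-- A weight on `k × k` matrices is nondegenerate when `c_1, …, c_k` are all nonzero. -/
def Nondegenerate [Fintype F] (w : Matrix (Fin k) (Fin k) F → ℕ) : Prop :=
  ∀ j : ℕ, 1 ≤ j → j ≤ k → degeneracyCoeff w j ≠ 0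

end Matrices

end WeightDuality

/-! Write q for the size of `F`. A left code is described by a family of column blocks `lam i`. A
matrix x encodes the codeword with entries x * `lam i`, and if every nonzero x has positive weight
this encoding is injective. The dual code consists of the y with ∑ `lam i` * y i = 0. If t is
positive and smaller than the sum of the weights of any two nonzero matrices, a dual word of weight
t has exactly one nonzero entry. Then the number of such words is additive over the family: it is
the sum of `dualCount w t (lam i)`. Respecting duality thus makes this sum a function of the weight
distribution of the code (`RespectsDuality.sum_dualCount_eq`), and both claims test this invariance.

Nondegenerate case. Let t be the least nonzero weight. Combinations of column blocks on which all
weights vanish cannot change the dual count, so `dualCount w t l` minus its value at l = 0 is a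
combination of the functions l ↦ w (x * l). After averaging over both unit groups the coefficient of
x depends only on its rank (`RespectsDuality.exists_rank_kernel`). Nondegeneracy enters next. The
c_j are, up to nonzero factors, character sums of w. If none vanishes, every left invariant function
of x that is zero at 0 is a rational combination of weight functions (`exists_sum_mul_weight_eq`).
Hence codes can be built whose weights on two equinumerous sets S and S' are interchanged. Such a
swap preserves the distribution, so the kernel has equal sums over S and S'. Taking S of rank r and
S' of rank r + 1 shows that the kernel is constant on the ranks 1, 2, 3
(`RespectsDuality.kernel_succ`).

The change in the dual count is then a constant times ∑ w (x * l). Evaluation at l of rank 1, 2 and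
3 gives three equations between the w_i and the indicators of w_i = t. These force either w_1 = w_2
= w_3, a multiple of the Hamming weight, or q w_2 = (q + 1) w_1, that is c_2 = 0
(`eq_or_eq_of_rank_equations`).

Degenerate case. If q w_2 = (q + 1) w_1, two explicit families on two columns give every x the same
weight: the q + 1 points of the projective line, and q copies of a rank 2 block together with one
zero block. Their numbers of dual words of a suitable small weight differ
(`not_respectsDuality_of_degenerate`). -/

namespace WeightDuality
open Matrix

set_option linter.unusedSectionVars false

/-! ### Equivalence of matrices under invertible row and column operations -/

section LinearAlgebra

variable {F : Type*} [Field F] {m n : Type*} [Fintype m] [DecidableEq m] [Fintype n] [DecidableEq n]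

/-- A linear automorphism of `m → F`, as an invertible matrix. -/
lemma exists_unit_mulVec_eq (e : (m → F) ≃ₗ[F] (m → F)) :
    ∃ U : (Matrix m m F)ˣ, ∀ v, (U : Matrix m m F) *ᵥ v = e v := by
  refine ⟨⟨LinearMap.toMatrix' (e : (m → F) →ₗ[F] (m → F)),
    LinearMap.toMatrix' (e.symm : (m → F) →ₗ[F] (m → F)), ?_, ?_⟩, fun v => ?_⟩
  · rw [← LinearMap.toMatrix'_comp]; simp
  · rw [← LinearMap.toMatrix'_comp]; simp
  · simp [LinearMap.toMatrix'_mulVec]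

/-- Both ranges are identified with the quotient by the common kernel. The resulting isomorphism A v
↦ B v between subspaces extends to an automorphism of the whole space. -/
lemma exists_unit_mul_eq_of_ker_eq (A B : Matrix m n F)
    (h : ∀ v, A *ᵥ v = 0 ↔ B *ᵥ v = 0) :
    ∃ U : (Matrix m m F)ˣ, (U : Matrix m m F) * A = B := by
  have hk : LinearMap.ker A.mulVecLin = LinearMap.ker B.mulVecLin := by
    ext v; simpa using h v
  let e : LinearMap.range A.mulVecLin ≃ₗ[F] LinearMap.range B.mulVecLin :=
    A.mulVecLin.quotKerEquivRange.symm ≪≫ₗ Submodule.quotEquivOfEq _ _ hk ≪≫ₗ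
      B.mulVecLin.quotKerEquivRange
  obtain ⟨g, hg⟩ := Submodule.exists_linearEquiv_restrict_eq e
  obtain ⟨U, hU⟩ := exists_unit_mulVec_eq g
  refine ⟨U, Matrix.ext_of_mulVec_single fun j => ?_⟩
  rw [← mulVec_mulVec, hU]
  have := hg ⟨A.mulVecLin (Pi.single j 1), LinearMap.mem_range_self _ _⟩
  simp only [mulVecLin_apply] at this
  rw [← this]
  have h2 : A.mulVecLin.quotKerEquivRange.symm
      ⟨A.mulVecLin (Pi.single j 1), LinearMap.mem_range_self _ _⟩ =
      Submodule.Quotient.mk (Pi.single j 1) := by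
    rw [LinearEquiv.symm_apply_eq]; rfl
  simp only [e, LinearEquiv.trans_apply]
  erw [h2]
  rfl

/-- Equal ranks give kernels of equal dimension, so a column operation moves one kernel onto the
other. The case of equal kernels then supplies the row operation. -/
lemma exists_units_mul_mul_eq_of_rank_eq (A B : Matrix m n F) (h : A.rank = B.rank) :
    ∃ (U : (Matrix m m F)ˣ) (V : (Matrix n n F)ˣ),
      (U : Matrix m m F) * A * (V : Matrix n n F) = B := by
  have hf : Module.finrank F (LinearMap.ker B.mulVecLin) =
      Module.finrank F (LinearMap.ker A.mulVecLin) := by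
    have h1 := A.mulVecLin.finrank_range_add_finrank_ker
    have h2 := B.mulVecLin.finrank_range_add_finrank_ker
    simp only [Matrix.rank] at h
    omega
  obtain ⟨g, hg⟩ := Submodule.exists_linearEquiv_restrict_eq (LinearEquiv.ofFinrankEq _ _ hf)
  obtain ⟨V, hV⟩ := exists_unit_mulVec_eq g
  obtain ⟨U, hU⟩ := exists_unit_mul_eq_of_ker_eq (A * (V : Matrix n n F)) B (fun v => by
    rw [← mulVec_mulVec, hV]
    constructor
    · intro hv
      obtain ⟨v', hv'⟩ := (LinearEquiv.ofFinrankEq _ _ hf).surjective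
        ⟨g v, by simpa using hv⟩
      have h3 := hg v'
      rw [hv'] at h3
      have h4 : v = v' := g.injective h3
      have h5 := v'.2
      rw [← h4] at h5
      simpa using h5
    · intro hv
      have h3 := hg ⟨v, by simpa using hv⟩
      rw [← h3]
      exact LinearMap.mem_ker.1 ((LinearEquiv.ofFinrankEq _ _ hf) ⟨v, by simpa using hv⟩).2)
  exact ⟨U, V, by rw [Matrix.mul_assoc, hU]⟩

lemma mulVec_injective_iff_rank_eq (A : Matrix m n F) :
    (∀ v, A *ᵥ v = 0 → v = 0) ↔ A.rank = Fintype.card n := by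
  have h1 := A.mulVecLin.finrank_range_add_finrank_ker
  rw [Module.finrank_fintype_fun_eq_card] at h1
  have h2 : (∀ v, A *ᵥ v = 0 → v = 0) ↔ LinearMap.ker A.mulVecLin = ⊥ := by
    rw [LinearMap.ker_eq_bot']; simp
  rw [h2, ← Submodule.finrank_eq_zero (R := F)]
  simp only [Matrix.rank]
  omega

lemma rank_unit_mul (U : (Matrix m m F)ˣ) (A : Matrix m n F) :
    ((U : Matrix m m F) * A).rank = A.rank :=
  rank_mul_eq_right_of_isUnit_det _ _ ((isUnit_iff_isUnit_det _).1 U.isUnit)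

lemma rank_eq_zero_iff (A : Matrix m n F) : A.rank = 0 ↔ A = 0 := by
  classical
  constructor
  · intro h
    rw [Matrix.rank, Submodule.finrank_eq_zero, LinearMap.range_eq_bot] at h
    have := congrArg LinearMap.toMatrix' h
    simpa [← Matrix.toLin'_apply'] using this
  · rintro rfl; simp

/-- Left multiplication by an invertible matrix. -/
def unitMulEquiv (U : (Matrix m m F)ˣ) : Matrix m n F ≃ Matrix m n F where
  toFun x := (U : Matrix m m F) * x
  invFun x := ((U⁻¹ : (Matrix m m F)ˣ) : Matrix m m F) * x
  left_inv x := by beta_reduce; rw [← Matrix.mul_assoc, Units.inv_mul, Matrix.one_mul]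
  right_inv x := by beta_reduce; rw [← Matrix.mul_assoc, Units.mul_inv, Matrix.one_mul]

lemma sum_unit_mul [Fintype F] {X : Type*} [AddCommMonoid X] (U : (Matrix m m F)ˣ)
    (f : Matrix m n F → X) : ∑ x : Matrix m n F, f ((U : Matrix m m F) * x) = ∑ x, f x :=
  Equiv.sum_comp (unitMulEquiv U) f

/-- Right multiplication by an invertible matrix. -/
def mulUnitEquiv (V : (Matrix n n F)ˣ) : Matrix m n F ≃ Matrix m n F where
  toFun x := x * (V : Matrix n n F)
  invFun x := x * ((V⁻¹ : (Matrix n n F)ˣ) : Matrix n n F)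
  left_inv x := by beta_reduce; rw [Matrix.mul_assoc, Units.mul_inv, Matrix.mul_one]
  right_inv x := by beta_reduce; rw [Matrix.mul_assoc, Units.inv_mul, Matrix.mul_one]

lemma sum_mul_unit [Fintype F] {X : Type*} [AddCommMonoid X] (V : (Matrix n n F)ˣ)
    (f : Matrix m n F → X) : ∑ x : Matrix m n F, f (x * (V : Matrix n n F)) = ∑ x, f x :=
  Equiv.sum_comp (mulUnitEquiv V) f

end LinearAlgebra

/-! ### Two general tools: constant fibres and the double annihilator -/

/-- Summation along a surjective homomorphism of finite groups. -/
lemma card_mul_sum_comp_of_surjective {G H K : Type*} [AddGroup G] [AddGroup H] [Fintype G]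
    [Fintype H] [CommRing K] (φ : G →+ H) (hφ : Function.Surjective φ)
    (f : H → K) :
    (Fintype.card H : K) * ∑ g, f (φ g) = (Fintype.card G : K) * ∑ h, f h := by
  classical
  have hfib : ∀ h : H, (Finset.univ.filter fun g => φ g = h).card =
      (Finset.univ.filter fun g => φ g = 0).card := by
    intro h
    obtain ⟨g0, rfl⟩ := hφ h
    refine Finset.card_bij (fun g _ => g - g0) ?_ ?_ ?_
    · intro g hg; simp at hg ⊢; simp [hg]
    · intro a _ b _ hab; simpa using hab
    · intro b hb; refine ⟨b + g0, ?_, by simp⟩; simp at hb ⊢; simp [hb]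
  set k := (Finset.univ.filter fun g => φ g = 0).card
  have h1 : ∑ g, f (φ g) = (k : K) * ∑ h, f h := by
    rw [← Finset.sum_fiberwise (s := Finset.univ) (g := φ), Finset.mul_sum]
    refine Finset.sum_congr rfl fun h _ => ?_
    rw [Finset.sum_congr rfl (g := fun _ => f h) (fun g hg => by simp at hg; rw [hg]),
      Finset.sum_const, hfib, nsmul_eq_mul]
  have h2 : Fintype.card G = k * Fintype.card H := by
    have := Finset.card_eq_sum_card_fiberwise (s := (Finset.univ : Finset G))
      (t := (Finset.univ : Finset H)) (f := φ) (by simp)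
    rw [Finset.sum_congr rfl (fun h _ => hfib h)] at this
    simpa [mul_comm] using this
  rw [h1, h2]; push_cast; ring

/-- A function on a finite set is a combination of given ones as soon as every functional that
kills these kills it. -/
lemma exists_combination {α β K : Type*} [Field K] [Fintype α] [Fintype β] (A : α → β → K)
    (s : β → K)
    (h : ∀ ψ : β → K, (∀ a, ∑ b, ψ b * A a b = 0) → ∑ b, ψ b * s b = 0) :
    ∃ η : α → K, ∀ b, s b = ∑ a, η a * A a b := by
  classical
  let L (c : β → K) : (β → K) →ₗ[K] K := ∑ b, c b • LinearMap.proj b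
  have hL : ∀ c ψ, L c ψ = ∑ b, ψ b * c b := by
    intro c ψ; simp [L, mul_comm]
  have := mem_span_of_iInf_ker_le_ker (L := fun a => L (A a)) (K := L s) (by
    intro ψ hψ
    simp only [Submodule.mem_iInf, LinearMap.mem_ker, hL] at hψ ⊢
    exact h ψ hψ)
  obtain ⟨η, hη⟩ := (Submodule.mem_span_range_iff_exists_fun K).1 this
  refine ⟨η, fun b => ?_⟩
  have := LinearMap.congr_fun hη (Pi.single b 1)
  simpa [hL, Pi.single_apply] using this.symm

/-! ### Power moments of sums over matrices of fixed rank -/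

section RankSums

variable {F : Type*} [Field F] [Fintype F] {K : Type*} [Field K] {a : ℕ}

/-- The sum of the values of `θ` on the matrices of rank `i`. -/
noncomputable def rankSum (θ : Matrix (Fin 3) (Fin a) F → K) (i : ℕ) : K :=
  ∑ z : Matrix (Fin 3) (Fin a) F with z.rank = i, θ z

lemma sum_mul_rank (θ : Matrix (Fin 3) (Fin a) F → K) (f : ℕ → K) :
    ∑ z, θ z * f z.rank = ∑ i ∈ Finset.range (a + 1), rankSum θ i * f i := by
  rw [← Finset.sum_fiberwise_of_maps_to (s := Finset.univ) (t := Finset.range (a + 1))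
    (g := fun z : Matrix (Fin 3) (Fin a) F => z.rank)]
  · refine Finset.sum_congr rfl fun i _ => ?_
    rw [rankSum, Finset.sum_mul]
    refine Finset.sum_congr rfl fun z hz => ?_
    rw [(Finset.mem_filter.1 hz).2]
  · intro z _
    have := z.rank_le_width
    simp; omega

lemma rankSum_zero (θ : Matrix (Fin 3) (Fin a) F → K) : rankSum θ 0 = θ 0 := by
  rw [rankSum, Finset.sum_eq_single_of_mem 0 (by simp)]
  intro b hb hb0
  exact absurd ((rank_eq_zero_iff b).1 (Finset.mem_filter.1 hb).2) hb0

open Classical in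
lemma card_mul_eq_zero (z : Matrix (Fin 3) (Fin a) F) (t : ℕ) :
    (Finset.univ.filter fun V : Matrix (Fin a) (Fin t) F => z * V = 0).card =
      Fintype.card F ^ (t * (a - z.rank)) := by
  have h1 := z.mulVecLin.finrank_range_add_finrank_ker
  rw [Module.finrank_fintype_fun_eq_card, Fintype.card_fin] at h1
  have h2 : a - z.rank = Module.finrank F (LinearMap.ker z.mulVecLin) := by
    simp only [Matrix.rank]; omega
  let e : {V : Matrix (Fin a) (Fin t) F // z * V = 0} ≃
      (Fin t → LinearMap.ker z.mulVecLin) :=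
    { toFun := fun V j => ⟨V.1.col j, by
        have := congrArg (fun M => M.col j) V.2
        simp only [LinearMap.mem_ker, mulVecLin_apply]
        ext i
        exact congrFun this i⟩
      invFun := fun c => ⟨Matrix.of fun i j => (c j).1 i, by
        ext i j
        have := (c j).2
        simp only [LinearMap.mem_ker, mulVecLin_apply] at this
        exact congrFun this i⟩
      left_inv := fun V => rfl
      right_inv := fun c => rfl }
  rw [← Fintype.card_subtype, Fintype.card_congr e, Fintype.card_fun, Fintype.card_fin,
    Module.card_eq_pow_finrank (K := F), ← h2, ← pow_mul, mul_comm]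

-- Double counting of pairs with z * V = 0: each z of rank i occurs with q ^ (t * (a - i)) matrices
-- V. The rank sums thereby become accessible through sums over subspaces.
open Classical in
lemma sum_rankSum_mul_pow (θ : Matrix (Fin 3) (Fin a) F → K) (t : ℕ) :
    ∑ i ∈ Finset.range (a + 1), rankSum θ i * (Fintype.card F : K) ^ (t * (a - i)) =
      ∑ V : Matrix (Fin a) (Fin t) F, ∑ z : Matrix (Fin 3) (Fin a) F with (z * V : Matrix (Fin 3) (Fin t) F) = 0, θ z := by
  rw [← sum_mul_rank θ (fun i => (Fintype.card F : K) ^ (t * (a - i)))]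
  have : ∀ z : Matrix (Fin 3) (Fin a) F, (Fintype.card F : K) ^ (t * (a - z.rank)) =
      ∑ V : Matrix (Fin a) (Fin t) F, if z * V = 0 then (1 : K) else 0 := by
    intro z
    rw [Finset.sum_boole, card_mul_eq_zero]; push_cast; rfl
  simp_rw [this, Finset.mul_sum]
  rw [Finset.sum_comm]
  refine Finset.sum_congr rfl fun V _ => ?_
  rw [Finset.sum_filter]
  simp

lemma exists_vecMul_eq_zero {t : ℕ} (ht : t < a) (V : Matrix (Fin a) (Fin t) F) :
    ∃ u : Fin a → F, u ≠ 0 ∧ u ᵥ* V = 0 := by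
  have := LinearMap.ker_ne_bot_of_finrank_lt (f := Vᵀ.mulVecLin) (by simpa using ht)
  obtain ⟨u, h, hu⟩ := Submodule.exists_mem_ne_zero_of_ne_bot this
  exact ⟨u, hu, by simpa [mulVec_transpose] using h⟩

end RankSums

/-! ### Character sums over matrices of fixed rank -/

section Characters

variable {F : Type*} [Field F]

/-- The `m × a` matrix whose columns are the first `a` standard vectors. -/
def colIncl (F : Type*) [Field F] (m a : ℕ) : Matrix (Fin m) (Fin a) F :=
  Matrix.of fun i k => if (i : ℕ) = k then 1 else 0

lemma colIncl_mulVec_apply {m a : ℕ} (u : Fin a → F) (i : Fin m) :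
    (colIncl F m a *ᵥ u) i = if h : (i : ℕ) < a then u ⟨i, h⟩ else 0 := by
  simp only [colIncl, mulVec, dotProduct, of_apply, ite_mul, one_mul, zero_mul]
  split_ifs with h
  · rw [Finset.sum_eq_single ⟨i, h⟩]
    · simp
    · intro b _ hb
      rw [if_neg]; intro h'; apply hb; ext; simp [h']
    · simp
  · refine Finset.sum_eq_zero fun b _ => ?_
    rw [if_neg]; intro h'; exact h (h' ▸ b.2)

lemma colIncl_mulVec_injective {m a : ℕ} (h : a ≤ m) (u : Fin a → F)
    (hu : colIncl F m a *ᵥ u = 0) : u = 0 := by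
  ext k
  have := congrFun hu ⟨k, by omega⟩
  rw [colIncl_mulVec_apply] at this
  simpa using this

lemma exists_addChar_dotProduct_ne_one {n : Type*} [Fintype n] {χ : AddChar F ℂ} (hχ : χ ≠ 1)
    {w : n → F} (hw : w ≠ 0) : ∃ c : n → F, χ (c ⬝ᵥ w) ≠ 1 := by
  classical
  obtain ⟨x, hx⟩ := AddChar.ne_one_iff.1 hχ
  obtain ⟨i, hi⟩ := Function.ne_iff.1 hw
  refine ⟨Pi.single i (x / w i), ?_⟩
  rw [single_dotProduct, div_mul_cancel₀ _ hi]
  exact hx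

/-- A sum of character values over a set that is stable under a shift which multiplies them by a
factor other than `1`. -/
lemma sum_eq_zero_of_shift {G : Type*} [AddGroup G] [Fintype G] (f : G → ℂ) (g : G) (c : ℂ)
    (hc : c ≠ 1) (h : ∀ x, f (x + g) = f x * c) : ∑ x, f x = 0 := by
  have h1 : ∑ x, f x = (∑ x, f x) * c := by
    rw [Finset.sum_mul, ← Equiv.sum_comp (Equiv.addRight g)]
    exact Finset.sum_congr rfl fun x _ => by simp [h]
  have h2 : (∑ x, f x) * (c - 1) = 0 := by rw [mul_sub, ← h1]; ring
  exact (mul_eq_zero.1 h2).resolve_right (sub_ne_zero.2 hc)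

lemma trace_vecMulVec_mul {m a : ℕ} (u : Fin a → F) (c : Fin m → F)
    (G : Matrix (Fin m) (Fin a) F) : (vecMulVec u c * G).trace = c ⬝ᵥ (G *ᵥ u) := by
  rw [vecMulVec_mul, trace_vecMulVec, dotProduct_comm, dotProduct_mulVec]

variable [Fintype F]

/-- The character `z ↦ χ (z₀₀ + z₁₁ + ⋯)` of the group of `3 × a` matrices. -/
def traceChar (χ : AddChar F ℂ) (a : ℕ) (z : Matrix (Fin 3) (Fin a) F) : ℂ :=
  χ (zᵀ * colIncl F 3 a).trace

/-- Since t < a, every V has a nonzero u in its left kernel. The condition z * V = 0 is stable under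
shifts of z by `vecMulVec c u`, and for some c the character is not trivial on this shift, so each
inner sum vanishes. With the value 1 at rank 0 these moments determine the rank sums by a
Vandermonde system. -/
lemma rankSum_traceChar_moment {χ : AddChar F ℂ} (hχ : χ ≠ 1) {a t : ℕ} (ha : a ≤ 3) (ht : t < a) :
    ∑ i ∈ Finset.range (a + 1), rankSum (traceChar χ a) i * (Fintype.card F : ℂ) ^ (t * (a - i)) =
      0 := by
  classical
  rw [sum_rankSum_mul_pow]
  refine Finset.sum_eq_zero fun V _ => ?_
  obtain ⟨u, hu, huV⟩ := exists_vecMul_eq_zero ht V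
  have hG : colIncl F 3 a *ᵥ u ≠ 0 := fun h => hu (colIncl_mulVec_injective ha u h)
  obtain ⟨c, hc⟩ := exists_addChar_dotProduct_ne_one hχ hG
  rw [Finset.sum_filter]
  refine sum_eq_zero_of_shift _ (vecMulVec c u) _ hc fun z => ?_
  have h1 : (z + vecMulVec c u) * V = z * V := by
    rw [Matrix.add_mul, vecMulVec_mul, huV]; ext; simp [vecMulVec_apply]
  rw [h1]
  split_ifs
  · rw [traceChar, transpose_add, Matrix.add_mul, trace_add, AddChar.map_add_eq_mul,
      transpose_vecMulVec, trace_vecMulVec_mul]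
    rfl
  · simp

lemma rankSum_traceChar_zero (χ : AddChar F ℂ) (a : ℕ) : rankSum (traceChar χ a) 0 = 1 := by
  rw [rankSum_zero]; simp [traceChar]

lemma two_le_card : (2 : ℕ) ≤ Fintype.card F := Fintype.one_lt_card

lemma rankSum_traceChar_one {χ : AddChar F ℂ} (hχ : χ ≠ 1) : rankSum (traceChar χ 1) 1 = -1 := by
  have h := rankSum_traceChar_moment hχ (a := 1) (t := 0) (by norm_num) (by norm_num)
  simp [Finset.sum_range_succ, rankSum_traceChar_zero] at h
  linear_combination h

lemma card_sub_one_ne_zero : (Fintype.card F : ℂ) - 1 ≠ 0 := by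
  have := two_le_card (F := F)
  rw [sub_ne_zero]; norm_cast; omega

lemma rankSum_traceChar_two {χ : AddChar F ℂ} (hχ : χ ≠ 1) :
    rankSum (traceChar χ 2) 1 = -(Fintype.card F + 1) ∧
      rankSum (traceChar χ 2) 2 = Fintype.card F := by
  have h0 := rankSum_traceChar_moment hχ (a := 2) (t := 0) (by norm_num) (by norm_num)
  have h1 := rankSum_traceChar_moment hχ (a := 2) (t := 1) (by norm_num) (by norm_num)
  simp [Finset.sum_range_succ, rankSum_traceChar_zero] at h0 h1
  have hq := card_sub_one_ne_zero (F := F)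
  set q : ℂ := (Fintype.card F : ℂ)
  constructor <;> apply mul_left_cancel₀ hq
  · linear_combination h1 - h0
  · linear_combination q * h0 - h1

lemma rankSum_traceChar_three {χ : AddChar F ℂ} (hχ : χ ≠ 1) :
    rankSum (traceChar χ 3) 1 = -((Fintype.card F : ℂ) ^ 2 + Fintype.card F + 1) ∧
      rankSum (traceChar χ 3) 2 =
        Fintype.card F * ((Fintype.card F : ℂ) ^ 2 + Fintype.card F + 1) ∧
      rankSum (traceChar χ 3) 3 = -(Fintype.card F : ℂ) ^ 3 := by
  have h0 := rankSum_traceChar_moment hχ (a := 3) (t := 0) (by norm_num) (by norm_num)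
  have h1 := rankSum_traceChar_moment hχ (a := 3) (t := 1) (by norm_num) (by norm_num)
  have h2 := rankSum_traceChar_moment hχ (a := 3) (t := 2) (by norm_num) (by norm_num)
  simp [Finset.sum_range_succ, rankSum_traceChar_zero] at h0 h1 h2
  have hq := card_sub_one_ne_zero (F := F)
  have hq0 : (Fintype.card F : ℂ) ≠ 0 := by
    have := two_le_card (F := F)
    norm_cast; omega
  have hq1 : (Fintype.card F : ℂ) + 1 ≠ 0 := by norm_cast
  set q : ℂ := (Fintype.card F : ℂ)
  -- Moment t is an evaluation of T ^ t at the nodes q ^ 3, q ^ 2, q, 1. The combinations below come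
  -- from quadratics in T vanishing at two of the last three nodes; this product is their value, up
  -- to normalisation, at the remaining one.
  have hne : q * (q - 1) * (q - 1) * (q + 1) ≠ 0 := by positivity
  refine ⟨?_, ?_, ?_⟩ <;> apply mul_left_cancel₀ hne
  · linear_combination h2 - (q + 1) * h1 + q * h0
  · linear_combination -(q + 1) * (h2 - (q ^ 2 + 1) * h1 + q ^ 2 * h0)
  · linear_combination q * (h2 - q * (q + 1) * h1 + q ^ 3 * h0)

end Characters

/-! ### Numbers of matrices of given size and rank -/

section Counts

variable (F : Type*) [Field F] [Fintype F]

lemma card_matrix (m n : ℕ) : Fintype.card (Matrix (Fin m) (Fin n) F) = Fintype.card F ^ (m * n) := by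
  change Fintype.card (Fin m → Fin n → F) = _
  simp only [Fintype.card_fun, Fintype.card_fin, ← pow_mul, mul_comm]

/-- The number of `3 × a` matrices of rank `i`. -/
noncomputable def rankCount (a i : ℕ) : ℚ :=
  rankSum (fun _ : Matrix (Fin 3) (Fin a) F => (1 : ℚ)) i

lemma rankCount_zero (a : ℕ) : rankCount F a 0 = 1 := rankSum_zero _

lemma sum_rank (a : ℕ) (f : ℕ → ℚ) :
    ∑ z : Matrix (Fin 3) (Fin a) F, f z.rank =
      ∑ i ∈ Finset.range (a + 1), rankCount F a i * f i := by
  have := sum_mul_rank (fun _ : Matrix (Fin 3) (Fin a) F => (1 : ℚ)) f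
  simp only [one_mul] at this
  exact this

lemma sum_rankCount (a : ℕ) :
    ∑ i ∈ Finset.range (a + 1), rankCount F a i = (Fintype.card F : ℚ) ^ (3 * a) := by
  have := sum_rank F a (fun _ => 1)
  simp only [mul_one] at this
  rw [← this]
  simp [card_matrix]

lemma rankCount_self {a : ℕ} (ha : a ≤ 3) :
    rankCount F a a = ∏ i : Fin a, ((Fintype.card F : ℚ) ^ 3 - (Fintype.card F : ℚ) ^ (i : ℕ)) := by
  classical
  have h := card_linearIndependent (K := F) (V := Fin 3 → F) (k := a) (by simpa using ha)
  rw [Module.finrank_fintype_fun_eq_card, Fintype.card_fin] at h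
  have h2 : rankCount F a a = (Nat.card {s : Fin a → (Fin 3 → F) // LinearIndependent F s} : ℚ) := by
    rw [rankCount, rankSum, Finset.sum_const, nsmul_eq_mul, mul_one, ← Fintype.card_subtype,
      ← Nat.card_eq_fintype_card]
    congr 1
    refine Nat.card_congr ⟨fun z => ⟨z.1.col, ?_⟩, fun s => ⟨(Matrix.of s.1)ᵀ, ?_⟩, fun z => rfl,
      fun s => rfl⟩
    · rw [linearIndependent_iff_card_eq_finrank_span, Set.finrank, ← rank_eq_finrank_span_cols, z.2,
        Fintype.card_fin]
    · have := linearIndependent_iff_card_eq_finrank_span.1 s.2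
      rw [Set.finrank, Fintype.card_fin] at this
      rw [rank_eq_finrank_span_cols]
      exact this.symm
  rw [h2, h, Nat.cast_prod]
  refine Finset.prod_congr rfl fun i _ => ?_
  rw [Nat.cast_sub]
  · push_cast; rfl
  · exact Nat.pow_le_pow_right Fintype.card_pos (by omega)

lemma rankCount_one_one : rankCount F 1 1 = (Fintype.card F : ℚ) ^ 3 - 1 := by
  rw [rankCount_self F (by norm_num)]; simp

lemma rankCount_two_two : rankCount F 2 2 =
    ((Fintype.card F : ℚ) ^ 3 - 1) * ((Fintype.card F : ℚ) ^ 3 - Fintype.card F) := by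
  rw [rankCount_self F (by norm_num)]; simp [Fin.prod_univ_succ]

lemma rankCount_three_three : rankCount F 3 3 =
    ((Fintype.card F : ℚ) ^ 3 - 1) * ((Fintype.card F : ℚ) ^ 3 - Fintype.card F) *
      ((Fintype.card F : ℚ) ^ 3 - (Fintype.card F : ℚ) ^ 2) := by
  rw [rankCount_self F (by norm_num)]; simp [Fin.prod_univ_succ, mul_assoc]

lemma rankCount_two_one : rankCount F 2 1 =
    (Fintype.card F + 1) * ((Fintype.card F : ℚ) ^ 3 - 1) := by
  have h := sum_rankCount F 2
  simp only [Finset.sum_range_succ, Finset.sum_range_zero, rankCount_zero,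
    rankCount_two_two] at h
  linear_combination h

/-- The moment t = 1 of the constant function. The column V = 0 is killed by all q ^ 9 matrices, and
each of the q ^ 3 - 1 other columns by q ^ 6 of them. Together with the total count it yields the
numbers of matrices of rank 1 and 2. -/
lemma rankCount_three_moment : (Fintype.card F : ℚ) ^ 3 + rankCount F 3 1 * Fintype.card F ^ 2 +
    rankCount F 3 2 * Fintype.card F + rankCount F 3 3 =
      (Fintype.card F : ℚ) ^ 9 + ((Fintype.card F : ℚ) ^ 3 - 1) * (Fintype.card F : ℚ) ^ 6 := by
  classical
  have h := sum_rankSum_mul_pow (fun _ : Matrix (Fin 3) (Fin 3) F => (1 : ℚ)) 1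
  have hV : ∀ V : Matrix (Fin 3) (Fin 1) F,
      ∑ z : Matrix (Fin 3) (Fin 3) F with (z * V : Matrix (Fin 3) (Fin 1) F) = 0, (1 : ℚ) =
        if V = 0 then (Fintype.card F : ℚ) ^ 9 else (Fintype.card F : ℚ) ^ 6 := by
    intro V
    split_ifs with h0
    · subst h0
      simp [card_matrix]
    · obtain ⟨i, hi⟩ : ∃ i, V i 0 ≠ 0 := by
        by_contra! hc
        exact h0 (by ext i j; rw [Subsingleton.elim j 0]; exact hc i)
      let φ : Matrix (Fin 3) (Fin 3) F →+ Matrix (Fin 3) (Fin 1) F :=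
        { toFun := fun z => z * V
          map_zero' := by simp
          map_add' := fun _ _ => Matrix.add_mul _ _ _ }
      have hφ : Function.Surjective φ := by
        intro y
        refine ⟨Matrix.of fun k l => if l = i then y k 0 / V i 0 else 0, ?_⟩
        ext k j
        rw [Subsingleton.elim j 0]
        simp [φ, mul_apply, hi]
      have := card_mul_sum_comp_of_surjective φ hφ (fun y => if y = 0 then (1 : ℚ) else 0)
      rw [Finset.sum_ite_eq' Finset.univ (0 : Matrix (Fin 3) (Fin 1) F)] at this
      have hc : (Fintype.card (Matrix (Fin 3) (Fin 1) F) : ℚ) = (Fintype.card F : ℚ) ^ 3 := by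
        simp [card_matrix]
      have hc' : (Fintype.card (Matrix (Fin 3) (Fin 3) F) : ℚ) = (Fintype.card F : ℚ) ^ 9 := by
        simp [card_matrix]
      rw [hc, hc'] at this
      have hq : (Fintype.card F : ℚ) ≠ 0 := by simp
      rw [Finset.sum_filter]
      apply mul_left_cancel₀ (pow_ne_zero 3 hq)
      simp only [Finset.mem_univ, if_true] at this
      refine Eq.trans this ?_
      ring
  rw [Finset.sum_congr rfl fun V _ => hV V, ← Finset.add_sum_erase _ _ (Finset.mem_univ 0),
    if_pos rfl, Finset.sum_congr rfl (fun V hV => if_neg (Finset.ne_of_mem_erase hV)),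
    Finset.sum_const, Finset.card_erase_of_mem (Finset.mem_univ _), Finset.card_univ,
    nsmul_eq_mul] at h
  have hc : Fintype.card (Matrix (Fin 3) (Fin 1) F) = Fintype.card F ^ 3 := by
    simp [card_matrix]
  rw [hc, Nat.cast_sub (Nat.one_le_pow _ _ Fintype.card_pos)] at h
  simp only [Finset.sum_range_succ, Finset.sum_range_zero] at h
  push_cast at h
  rw [← h]
  have := rankCount_zero F 3
  rw [rankCount] at this
  rw [this]
  simp [rankCount]

lemma rankCount_three_one : rankCount F 3 1 =
    ((Fintype.card F : ℚ) ^ 2 + Fintype.card F + 1) * ((Fintype.card F : ℚ) ^ 3 - 1) := by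
  have h0 := sum_rankCount F 3
  have h1 := rankCount_three_moment F
  simp only [Finset.sum_range_succ, Finset.sum_range_zero, rankCount_zero,
    rankCount_three_three] at h0 h1
  have := two_le_card (F := F)
  have hq : (2 : ℚ) ≤ Fintype.card F := by exact_mod_cast this
  set q : ℚ := (Fintype.card F : ℚ)
  have hne : q * (q - 1) ≠ 0 := mul_ne_zero (by linarith) (by linarith)
  apply mul_left_cancel₀ hne
  linear_combination h1 - q * h0

lemma rankCount_three_two : rankCount F 3 2 =
    ((Fintype.card F : ℚ) ^ 2 + Fintype.card F + 1) * ((Fintype.card F : ℚ) ^ 3 - 1) *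
      ((Fintype.card F : ℚ) ^ 3 - Fintype.card F) := by
  have h0 := sum_rankCount F 3
  simp only [Finset.sum_range_succ, Finset.sum_range_zero, rankCount_zero,
    rankCount_three_three, rankCount_three_one] at h0
  linear_combination h0

end Counts

/-! ### Codes from column blocks and their light dual words -/

section Codes

variable {F : Type*} [Field F] {ι I I' : Type*} [Fintype ι] [DecidableEq ι]

/-- The code generated by a matrix whose columns are the `3`-column blocks `lam i`. -/
def code {n : ℕ} (lam : Fin n → Matrix ι (Fin 3) F) :
    Submodule (Matrix (Fin 3) (Fin 3) F) (Fin n → Matrix (Fin 3) (Fin 3) F) where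
  carrier := {c | ∃ x : Matrix (Fin 3) ι F, ∀ i, c i = x * lam i}
  zero_mem' := ⟨0, by simp⟩
  add_mem' := by
    rintro c d ⟨x, hx⟩ ⟨y, hy⟩
    exact ⟨x + y, fun i => by simp [hx, hy, Matrix.add_mul]⟩
  smul_mem' := by
    rintro r c ⟨x, hx⟩
    exact ⟨r * x, fun i => by simp [hx, Matrix.mul_assoc]⟩

lemma mem_rightDual_code {n : ℕ} (lam : Fin n → Matrix ι (Fin 3) F)
    (y : Fin n → Matrix (Fin 3) (Fin 3) F) :
    y ∈ rightDual (code lam : Set (Fin n → Matrix (Fin 3) (Fin 3) F)) ↔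
      ∑ i, lam i * y i = 0 := by
  constructor
  · intro h
    have h1 : ∀ x : Matrix (Fin 3) ι F, x * ∑ i, lam i * y i = 0 := by
      intro x
      have := h (fun i => x * lam i) ⟨x, fun i => rfl⟩
      simpa [Matrix.mul_sum, Matrix.mul_assoc] using this
    ext j k
    -- Every row of this x is the j-th standard vector, so the product reads off row j.
    have := congrFun (congrFun (h1 (Matrix.of fun _ l => if l = j then 1 else 0)) 0) k
    simpa [mul_apply] using this
  · rintro h c ⟨x, hx⟩
    simp only [hx, Matrix.mul_assoc, ← Matrix.mul_sum, h, Matrix.mul_zero]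

variable [Fintype F] (w : Matrix (Fin 3) (Fin 3) F → ℕ)

/-- The number of elements of weight `t` that are killed by `lam`. -/
noncomputable def dualCount (t : ℕ) (lam : Matrix ι (Fin 3) F) : ℕ :=
  Nat.card {r : Matrix (Fin 3) (Fin 3) F // w r = t ∧ lam * r = 0}

variable {w}

lemma injective_of_weight_pos (hw_zero : w 0 = 0) {n : ℕ} (lam : Fin n → Matrix ι (Fin 3) F)
    (h : ∀ x : Matrix (Fin 3) ι F, x ≠ 0 → 0 < ∑ i, w (x * lam i)) :
    Function.Injective fun (x : Matrix (Fin 3) ι F) i => x * lam i := by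
  intro x y hxy
  by_contra hne
  have := h (x - y) (sub_ne_zero.2 hne)
  have h0 : ∀ i, (x - y) * lam i = 0 := fun i => by
    rw [Matrix.sub_mul, sub_eq_zero]; exact congrFun hxy i
  simp [h0, hw_zero] at this

lemma weightEnumerator_code (hw_zero : w 0 = 0) {n : ℕ} (lam : Fin n → Matrix ι (Fin 3) F)
    (h : ∀ x : Matrix (Fin 3) ι F, x ≠ 0 → 0 < ∑ i, w (x * lam i)) :
    weightEnumerator w (code lam : Set (Fin n → Matrix (Fin 3) (Fin 3) F)) =
      ∑ x : Matrix (Fin 3) ι F,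
        MvPolynomial.X 0 ^ (n * maxWeight w - ∑ i, w (x * lam i)) *
          MvPolynomial.X 1 ^ (∑ i, w (x * lam i)) := by
  classical
  rw [weightEnumerator]
  symm
  refine Finset.sum_bij (fun x _ => fun i => x * lam i) ?_ ?_ ?_ ?_
  · intro x _
    simp only [Finset.mem_filter, Finset.mem_univ, true_and]
    exact ⟨x, fun i => rfl⟩
  · intro x _ y _ hxy
    exact injective_of_weight_pos hw_zero lam h hxy
  · intro c hc
    simp only [Finset.mem_filter, Finset.mem_univ, true_and] at hc
    obtain ⟨x, hx⟩ := hc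
    exact ⟨x, Finset.mem_univ _, funext fun i => (hx i).symm⟩
  · intro x _
    rfl

lemma card_weight_eq_of_weightEnumerator_eq {n : ℕ}
    {C D : Set (Fin n → Matrix (Fin 3) (Fin 3) F)}
    (h : weightEnumerator w C = weightEnumerator w D) (t : ℕ) :
    Nat.card {y : Fin n → Matrix (Fin 3) (Fin 3) F // y ∈ C ∧ vecWeight w y = t} =
      Nat.card {y : Fin n → Matrix (Fin 3) (Fin 3) F // y ∈ D ∧ vecWeight w y = t} := by
  classical
  have key : ∀ C : Set (Fin n → Matrix (Fin 3) (Fin 3) F),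
      (MvPolynomial.aeval ![(1 : Polynomial ℂ), Polynomial.X] (weightEnumerator w C)).coeff t =
        (Nat.card {y : Fin n → Matrix (Fin 3) (Fin 3) F // y ∈ C ∧ vecWeight w y = t} : ℂ) := by
    intro C
    -- Setting X = 1 dehomogenises the enumerator; the coefficient of Y ^ t then counts the words of
    -- weight t.
    rw [weightEnumerator, map_sum, Polynomial.finsetSum_coeff]
    simp only [map_mul, map_pow, MvPolynomial.aeval_X, Matrix.cons_val_zero, one_pow, one_mul,
      Matrix.cons_val_one, Polynomial.coeff_X_pow]
    rw [Finset.sum_boole, Nat.card_eq_fintype_card, Fintype.card_subtype, Finset.filter_filter]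
    simp only [eq_comm]
  have := key C
  rw [h, key D] at this
  exact_mod_cast this.symm

/-- Two nonzero entries already weigh more than t, so a dual word of weight t is `Pi.single i r`. It
lies in the dual exactly when `lam i` * r = 0, which makes the count additive over the coordinates.
-/
lemma card_rightDual_weight (hw_zero : w 0 = 0) {n : ℕ}
    (lam : Fin n → Matrix ι (Fin 3) F) {t : ℕ} (ht : 0 < t)
    (hsingle : ∀ r s, r ≠ 0 → s ≠ 0 → t < w r + w s) :
    Nat.card {y : Fin n → Matrix (Fin 3) (Fin 3) F //
      y ∈ rightDual (code lam : Set (Fin n → Matrix (Fin 3) (Fin 3) F)) ∧ vecWeight w y = t} =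
        ∑ i, dualCount w t (lam i) := by
  classical
  simp only [dualCount, Nat.card_eq_fintype_card]
  rw [← Fintype.card_sigma]
  symm
  have hsum : ∀ i (r : Matrix (Fin 3) (Fin 3) F),
      ∑ j, lam j * (Pi.single i r : Fin n → Matrix (Fin 3) (Fin 3) F) j = lam i * r := by
    intro i r
    rw [Finset.sum_eq_single i]
    · simp
    · intro j _ hj; simp [hj]
    · simp
  have hwt : ∀ i (r : Matrix (Fin 3) (Fin 3) F),
      vecWeight w (Pi.single i r : Fin n → Matrix (Fin 3) (Fin 3) F) = w r := by
    intro i r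
    rw [vecWeight, Finset.sum_eq_single i]
    · simp
    · intro j _ hj; simp [hj, hw_zero]
    · simp
  refine Fintype.card_of_bijective (f := fun s => ⟨Pi.single s.1 s.2.1, ?_, ?_⟩) ⟨?_, ?_⟩
  · rw [mem_rightDual_code, hsum]; exact s.2.2.2
  · rw [hwt]; exact s.2.2.1
  · rintro ⟨i, r, hr, hr'⟩ ⟨j, s, hs, hs'⟩ h
    have h1 : (Pi.single i r : Fin n → Matrix (Fin 3) (Fin 3) F) = Pi.single j s :=
      congrArg Subtype.val h
    have hr0 : r ≠ 0 := by rintro rfl; omega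
    have hij : i = j := by
      by_contra hne
      have := congrFun h1 i
      rw [Pi.single_eq_same, Pi.single_eq_of_ne hne] at this
      exact hr0 this
    subst hij
    have := congrFun h1 i
    simp only [Pi.single_eq_same] at this
    subst this
    rfl
  · rintro ⟨y, hy, hyt⟩
    obtain ⟨i, hi⟩ : ∃ i, y i ≠ 0 := by
      by_contra! hc
      simp [vecWeight, hc, hw_zero] at hyt
      omega
    have hy' : y = Pi.single i (y i) := by
      ext1 j
      by_cases hj : j = i
      · subst hj; simp
      · rw [Pi.single_eq_of_ne hj]
        by_contra hne
        have h1 := hsingle _ _ hi hne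
        have h2 : w (y i) + w (y j) ≤ vecWeight w y := by
          rw [vecWeight, ← Finset.sum_pair (f := fun k => w (y k)) (Ne.symm hj)]
          exact Finset.sum_le_sum_of_subset (Finset.subset_univ _)
        omega
    refine ⟨⟨i, y i, ?_, ?_⟩, ?_⟩
    · rw [hy', hwt] at hyt
      exact hyt
    · rw [mem_rightDual_code, hy', hsum] at hy
      exact hy
    · simp only [Subtype.mk.injEq]
      exact hy'.symm

/-- For a weight that respects duality, families with the same distribution of weights have the
same number of dual words of a weight that is too small for words with two nonzero entries. -/
lemma RespectsDuality.sum_dualCount_eq (h : RespectsDuality w) (hw_zero : w 0 = 0)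
    [Fintype I] [Fintype I'] [Nonempty I]
    (hcard : Fintype.card I = Fintype.card I')
    (lam : I → Matrix ι (Fin 3) F) (lam' : I' → Matrix ι (Fin 3) F)
    (hlam : ∀ x : Matrix (Fin 3) ι F, x ≠ 0 → 0 < ∑ i, w (x * lam i))
    (hlam' : ∀ x : Matrix (Fin 3) ι F, x ≠ 0 → 0 < ∑ i, w (x * lam' i))
    (hdist : ∀ φ : ℕ → MvPolynomial (Fin 2) ℂ,
      ∑ x : Matrix (Fin 3) ι F, φ (∑ i, w (x * lam i)) =
        ∑ x : Matrix (Fin 3) ι F, φ (∑ i, w (x * lam' i)))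
    {t : ℕ} (ht : 0 < t) (hsingle : ∀ r s, r ≠ 0 → s ≠ 0 → t < w r + w s) :
    ∑ i, dualCount w t (lam i) = ∑ i, dualCount w t (lam' i) := by
  let e := Fintype.equivFin I
  let e' := Fintype.equivFinOfCardEq hcard.symm
  have hs : ∀ (φ : Matrix ι (Fin 3) F → ℕ), ∑ i, φ (lam (e.symm i)) = ∑ i, φ (lam i) :=
    fun φ => Equiv.sum_comp e.symm fun i => φ (lam i)
  have hs' : ∀ (φ : Matrix ι (Fin 3) F → ℕ), ∑ i, φ (lam' (e'.symm i)) = ∑ i, φ (lam' i) :=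
    fun φ => Equiv.sum_comp e'.symm fun i => φ (lam' i)
  have h1 := h (Fintype.card I) Fintype.card_pos (code fun i => lam (e.symm i))
    (code fun i => lam' (e'.symm i)) (by
      rw [weightEnumerator_code hw_zero, weightEnumerator_code hw_zero]
      · have e1 := fun x : Matrix (Fin 3) ι F => hs fun l => w (x * l)
        have e2 := fun x : Matrix (Fin 3) ι F => hs' fun l => w (x * l)
        simp only [e1, e2]
        exact hdist fun k => MvPolynomial.X 0 ^ (Fintype.card I * maxWeight w - k) *
          MvPolynomial.X 1 ^ k
      · intro x hx; rw [hs' fun l => w (x * l)]; exact hlam' x hx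
      · intro x hx; rw [hs fun l => w (x * l)]; exact hlam x hx)
  have h2 := card_weight_eq_of_weightEnumerator_eq h1 t
  rw [card_rightDual_weight hw_zero _ ht hsingle,
    card_rightDual_weight hw_zero _ ht hsingle, hs, hs'] at h2
  exact h2

/-- A family is recorded by the multiplicity of each column block. The nonzero multiplicity of the
zero block guarantees a positive length. -/
lemma RespectsDuality.sum_mul_dualCount_eq (h : RespectsDuality w) (hw_zero : w 0 = 0)
    (m m' : Matrix ι (Fin 3) F → ℕ)
    (hcard : ∑ l, m l = ∑ l, m' l) (hm0 : m 0 ≠ 0)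
    (hm : ∀ x : Matrix (Fin 3) ι F, x ≠ 0 → 0 < ∑ l, m l * w (x * l))
    (hm' : ∀ x : Matrix (Fin 3) ι F, x ≠ 0 → 0 < ∑ l, m' l * w (x * l))
    (hdist : ∀ φ : ℕ → MvPolynomial (Fin 2) ℂ,
      ∑ x : Matrix (Fin 3) ι F, φ (∑ l, m l * w (x * l)) =
        ∑ x : Matrix (Fin 3) ι F, φ (∑ l, m' l * w (x * l)))
    {t : ℕ} (ht : 0 < t) (hsingle : ∀ r s, r ≠ 0 → s ≠ 0 → t < w r + w s) :
    ∑ l, m l * dualCount w t l = ∑ l, m' l * dualCount w t l := by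
  have hs : ∀ (m φ : Matrix ι (Fin 3) F → ℕ),
      ∑ i : (l : Matrix ι (Fin 3) F) × Fin (m l), φ i.1 = ∑ l, m l * φ l := by
    intro m φ
    rw [Fintype.sum_sigma]
    simp
  have : Nonempty ((l : Matrix ι (Fin 3) F) × Fin (m l)) := ⟨⟨0, ⟨0, Nat.pos_of_ne_zero hm0⟩⟩⟩
  have := h.sum_dualCount_eq hw_zero (I := (l : Matrix ι (Fin 3) F) × Fin (m l))
    (I' := (l : Matrix ι (Fin 3) F) × Fin (m' l)) (by simpa using hcard)
    (fun i => i.1) (fun i => i.1)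
    (fun x hx => by rw [hs m fun l => w (x * l)]; exact hm x hx)
    (fun x hx => by rw [hs m' fun l => w (x * l)]; exact hm' x hx)
    (fun φ => by
      have e1 := fun x : Matrix (Fin 3) ι F => hs m fun l => w (x * l)
      have e2 := fun x : Matrix (Fin 3) ι F => hs m' fun l => w (x * l)
      simp only [e1, e2]
      exact hdist φ) ht hsingle
  rwa [hs, hs] at this

end Codes

/-! ### Swapping the weights of two sets of codewords -/

lemma exists_common_denominator {α : Type*} [Fintype α] (η : α → ℚ) :
    ∃ N : ℕ, 0 < N ∧ ∃ z : α → ℤ, ∀ a, (z a : ℚ) = N * η a := by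
  classical
  refine ⟨∏ a, (η a).den, Finset.prod_pos fun a _ => (η a).den_pos, ?_⟩
  refine ⟨fun a => (∏ b ∈ Finset.univ.erase a, (η b).den : ℕ) * (η a).num, fun a => ?_⟩
  rw [← Finset.prod_erase_mul _ _ (Finset.mem_univ a)]
  push_cast
  rw [mul_assoc]
  congr 1
  rw [mul_comm, Rat.mul_den_eq_num]

lemma sum_eq_sum_of_swap {α X : Type*} [Fintype α] [AddCommGroup X] {S S' : Finset α}
    (hd : Disjoint S S') (hc : S.card = S'.card) (f g : α → X) (u v : X)
    (hS : ∀ x ∈ S, f x = u ∧ g x = v) (hS' : ∀ x ∈ S', f x = v ∧ g x = u)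
    (h : ∀ x, x ∉ S → x ∉ S' → f x = g x) : ∑ x, f x = ∑ x, g x := by
  classical
  rw [← sub_eq_zero, ← Finset.sum_sub_distrib, ← Finset.sum_subset (Finset.subset_univ (S ∪ S')),
    Finset.sum_union hd, Finset.sum_congr rfl (g := fun _ => u - v),
    Finset.sum_congr (s₁ := S') rfl (g := fun _ => v - u)]
  · rw [Finset.sum_const, Finset.sum_const, hc, ← smul_add]; simp
  · intro x hx; rw [(hS' x hx).1, (hS' x hx).2]
  · intro x hx; rw [(hS x hx).1, (hS x hx).2]
  · intro x _ hx
    simp only [Finset.mem_union, not_or] at hx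
    rw [h x hx.1 hx.2, sub_self]

section Swap

variable {F : Type*} [Field F] [Fintype F] {ι : Type*} [Fintype ι] [DecidableEq ι]
  {w : Matrix (Fin 3) (Fin 3) F → ℕ}

lemma exists_mul_ne_zero {x : Matrix (Fin 3) ι F} (hx : x ≠ 0) :
    ∃ l : Matrix ι (Fin 3) F, x * l ≠ 0 := by
  by_contra! hc
  apply hx
  ext i j
  have := congrFun (congrFun (hc (Matrix.of fun k _ => if k = j then 1 else 0)) i) 0
  simpa [mul_apply] using this

/-- Swapping the weights on two sets of the same size on which some base family has constant
weight gives a linear relation between the numbers of dual words. -/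
lemma RespectsDuality.sum_mul_dualCount_sub_eq_zero (h : RespectsDuality w) (hw_zero : w 0 = 0)
    (hw_pos : ∀ r, r ≠ 0 → 0 < w r) [DecidableEq (Matrix (Fin 3) ι F)]
    (β : Matrix ι (Fin 3) F → ℕ) (hβ : ∀ l, 1 ≤ β l)
    {S S' : Finset (Matrix (Fin 3) ι F)} (hd : Disjoint S S') (hc : S.card = S'.card) (a : ℕ)
    (ha : ∀ x, x ∈ S ∨ x ∈ S' → ∑ l, β l * w (x * l) = a) (η η' : Matrix ι (Fin 3) F → ℚ)
    (hη : ∀ x, ∑ l, η l * (w (x * l) : ℚ) = if x ∈ S then 1 else 0)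
    (hη' : ∀ x, ∑ l, η' l * (w (x * l) : ℚ) = if x ∈ S' then 1 else 0)
    {t : ℕ} (ht : 0 < t) (hsingle : ∀ r s, r ≠ 0 → s ≠ 0 → t < w r + w s) :
    ∑ l, (η l - η' l) *
      ((dualCount w t l : ℚ) - dualCount w t (0 : Matrix ι (Fin 3) F)) = 0 := by
  classical
  obtain ⟨N, hN, z, hz⟩ := exists_common_denominator (Sum.elim η η')
  -- Large enough that L * β plus any of the integers z stays positive. The perturbed coefficients
  -- are then genuine multiplicities.
  set L : ℕ := 1 + ∑ s, (z s).natAbs with hL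
  have hbound : ∀ s l, 1 ≤ (L * β l + z s : ℤ) := by
    intro s l
    have h1 : (z s).natAbs ≤ ∑ s, (z s).natAbs :=
      Finset.single_le_sum (f := fun s => (z s).natAbs) (fun _ _ => Nat.zero_le _)
        (Finset.mem_univ s)
    have h2 : L ≤ L * β l := Nat.le_mul_of_pos_right _ (hβ l)
    have h3 : (L : ℤ) ≤ L * β l := by exact_mod_cast h2
    omega
  have hmult : ∀ s l, ∃ p : ℕ, 1 ≤ p ∧ (p : ℚ) = L * β l + z s := by
    intro s l
    refine ⟨(L * β l + z s : ℤ).toNat, by have := hbound s l; omega, ?_⟩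
    have : (((L * β l + z s : ℤ).toNat : ℤ) : ℚ) = ((L * β l + z s : ℤ) : ℚ) := by
      rw [Int.toNat_of_nonneg (by have := hbound s l; omega)]
    push_cast at this
    exact_mod_cast this
  choose p hp1 hp using fun l => hmult (Sum.inl l) l
  choose p' hp1' hp' using fun l => hmult (Sum.inr l) l
  simp only [hz, Sum.elim_inl, Sum.elim_inr] at hp hp'
  have hwt : ∀ x, ∑ l, p l * w (x * l) =
      L * (∑ l, β l * w (x * l)) + if x ∈ S then N else 0 := by
    intro x
    have h1 := hη x
    have : ((∑ l, p l * w (x * l) : ℕ) : ℚ) =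
        ((L * (∑ l, β l * w (x * l)) + if x ∈ S then N else 0 : ℕ) : ℚ) := by
      push_cast
      simp only [hp, add_mul, Finset.sum_add_distrib, mul_assoc, ← Finset.mul_sum]
      rw [h1]; simp
    exact_mod_cast this
  have hwt' : ∀ x, ∑ l, p' l * w (x * l) =
      L * (∑ l, β l * w (x * l)) + if x ∈ S' then N else 0 := by
    intro x
    have h1 := hη' x
    have : ((∑ l, p' l * w (x * l) : ℕ) : ℚ) =
        ((L * (∑ l, β l * w (x * l)) + if x ∈ S' then N else 0 : ℕ) : ℚ) := by
      push_cast
      simp only [hp', add_mul, Finset.sum_add_distrib, mul_assoc, ← Finset.mul_sum]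
      rw [h1]; simp
    exact_mod_cast this
  have hadd : ∀ (p φ : Matrix ι (Fin 3) F → ℕ) (T : ℕ),
      ∑ l, (p l + if l = 0 then T else 0) * φ l = ∑ l, p l * φ l + T * φ 0 := by
    intro p φ T
    simp [add_mul, Finset.sum_add_distrib]
  have hpos : ∀ p : Matrix ι (Fin 3) F → ℕ, (∀ l, 1 ≤ p l) →
      ∀ x : Matrix (Fin 3) ι F, x ≠ 0 → 0 < ∑ l, p l * w (x * l) := by
    intro p hp x hx
    obtain ⟨l, hl⟩ := exists_mul_ne_zero hx
    exact Finset.sum_pos' (fun _ _ => Nat.zero_le _)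
      ⟨l, Finset.mem_univ _, Nat.mul_pos (hp l) (hw_pos _ hl)⟩
  -- Each family is padded with zero blocks, as many as the other family has members. This equalises
  -- the lengths and leaves all weights unchanged. The values L * a + N and L * a are exchanged
  -- between S and S'.
  have key := h.sum_mul_dualCount_eq hw_zero (t := t)
    (fun l => p l + if l = 0 then ∑ l, p' l else 0)
    (fun l => p' l + if l = 0 then ∑ l, p l else 0)
    (by simp [Finset.sum_add_distrib, add_comm])
    (by have := hp1 0; simp; omega)
    (fun x hx => by rw [hadd p (fun l => w (x * l))]; have := hpos p hp1 x hx; omega)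
    (fun x hx => by rw [hadd p' (fun l => w (x * l))]; have := hpos p' hp1' x hx; omega)
    (fun φ => by
      have e1 := fun x : Matrix (Fin 3) ι F => hadd p (fun l => w (x * l)) (∑ l, p' l)
      have e2 := fun x : Matrix (Fin 3) ι F => hadd p' (fun l => w (x * l)) (∑ l, p l)
      simp only [e1, e2, hwt, hwt', Matrix.mul_zero, hw_zero, mul_zero, add_zero]
      refine sum_eq_sum_of_swap hd hc _ _ (φ (L * a + N)) (φ (L * a)) ?_ ?_ ?_
      · intro x hx
        have hx' := Finset.disjoint_left.1 hd hx
        simp [hx, hx', ha x (Or.inl hx)]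
      · intro x hx
        have hx' := Finset.disjoint_right.1 hd hx
        simp [hx, hx', ha x (Or.inr hx)]
      · intro x hx hx'
        simp [hx, hx'])
    ht hsingle
  rw [hadd p (fun l => dualCount w t l), hadd p' (fun l => dualCount w t l)] at key
  have key2 : (∑ l, (p l : ℚ) * dualCount w t l) + (∑ l, (p' l : ℚ)) *
      dualCount w t (0 : Matrix ι (Fin 3) F) = (∑ l, (p' l : ℚ) * dualCount w t l) +
        (∑ l, (p l : ℚ)) * dualCount w t (0 : Matrix ι (Fin 3) F) := by exact_mod_cast key
  have key3 : ∑ l, ((p l : ℚ) - p' l) *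
      ((dualCount w t l : ℚ) - dualCount w t (0 : Matrix ι (Fin 3) F)) = 0 := by
    simp only [sub_mul, mul_sub, Finset.sum_sub_distrib, ← Finset.sum_mul]
    linear_combination key2
  have hN0 : (N : ℚ) ≠ 0 := by exact_mod_cast hN.ne'
  apply mul_left_cancel₀ hN0
  rw [mul_zero, Finset.mul_sum, ← key3]
  refine Finset.sum_congr rfl fun l _ => ?_
  rw [hp, hp']; ring

end Swap

/-! ### The weight as a function of rank, and its character transform -/

section RankWeights

variable {F : Type*} [Field F]

lemma rank_rankMatrix {k i : ℕ} (hi : i ≤ k) : (rankMatrix F k i).rank = i := by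
  classical
  rw [rankMatrix, rank_diagonal]
  have : ∀ j : Fin k, ((if (j : ℕ) < i then (1 : F) else 0) ≠ 0) ↔ (j : ℕ) < i := by
    intro j; split_ifs with h <;> simp [h]
  rw [Fintype.card_congr (Equiv.subtypeEquivRight this)]
  rw [Fintype.card_congr (⟨fun j => ⟨j.1.1, j.2⟩, fun j => ⟨⟨j.1, by omega⟩, j.2⟩,
    fun j => rfl, fun j => rfl⟩ : {j : Fin k // (j : ℕ) < i} ≃ Fin i)]
  simp

lemma MaximalSymmetry.eq_rankWeight {w : Matrix (Fin 3) (Fin 3) F → ℕ} (hw : MaximalSymmetry w)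
    (r : Matrix (Fin 3) (Fin 3) F) : w r = rankWeight w r.rank := by
  obtain ⟨U, V, h⟩ := exists_units_mul_mul_eq_of_rank_eq (rankMatrix F 3 r.rank) r
    (rank_rankMatrix r.rank_le_width)
  rw [rankWeight]
  conv_lhs => rw [← h]
  rw [hw.2, hw.1]

lemma rankWeight_zero {w : Matrix (Fin 3) (Fin 3) F → ℕ} (hw_zero : w 0 = 0) :
    rankWeight w 0 = 0 := by
  simpa [rankWeight, rankMatrix] using hw_zero

lemma rank_mul_eq_of_injective {l m n : Type*} [Fintype l] [Fintype m] [Fintype n] [DecidableEq m]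
    [DecidableEq l] [DecidableEq n]
    (A : Matrix l m F) (B : Matrix m n F) (hA : ∀ v, A *ᵥ v = 0 → v = 0) :
    (A * B).rank = B.rank := by
  obtain ⟨g, hg⟩ := A.mulVecLin.exists_leftInverse_of_injective (by
    rw [LinearMap.ker_eq_bot']; simpa using hA)
  have h1 : LinearMap.toMatrix' g * A = 1 := by
    have := congrArg LinearMap.toMatrix' hg
    rw [LinearMap.toMatrix'_comp] at this
    simpa [← Matrix.toLin'_apply'] using this
  refine le_antisymm (rank_mul_le_right _ _) ?_
  calc B.rank = (LinearMap.toMatrix' g * (A * B)).rank := by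
        rw [← Matrix.mul_assoc, h1, Matrix.one_mul]
    _ ≤ _ := rank_mul_le_right _ _

variable [Fintype F]

lemma card_rat_ge_two : (2 : ℚ) ≤ Fintype.card F := by exact_mod_cast two_le_card (F := F)

lemma degeneracyCoeff_one {w : Matrix (Fin 3) (Fin 3) F → ℕ} (hw_zero : w 0 = 0) :
    degeneracyCoeff w 1 = rankWeight w 1 := by
  have hq := card_rat_ge_two (F := F)
  have h1 : (Fintype.card F : ℚ) - 1 ≠ 0 := by linarith
  simp [degeneracyCoeff, qBinomial, Finset.sum_range_succ, rankWeight_zero hw_zero, h1]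

lemma degeneracyCoeff_two {w : Matrix (Fin 3) (Fin 3) F → ℕ} (hw_zero : w 0 = 0) :
    degeneracyCoeff w 2 = Fintype.card F *
      (-(Fintype.card F + 1) * rankWeight w 1 + Fintype.card F * rankWeight w 2) := by
  have hq := card_rat_ge_two (F := F)
  have h1 : (Fintype.card F : ℚ) - 1 ≠ 0 := by linarith
  have h2 : (Fintype.card F : ℚ) ^ 2 - 1 ≠ 0 := by nlinarith
  simp [degeneracyCoeff, qBinomial, Finset.sum_range_succ, Finset.prod_range_succ,
    rankWeight_zero hw_zero]
  field_simp
  ring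

lemma degeneracyCoeff_three {w : Matrix (Fin 3) (Fin 3) F → ℕ} (hw_zero : w 0 = 0) :
    degeneracyCoeff w 3 = -(Fintype.card F : ℚ) ^ 3 *
      (-((Fintype.card F : ℚ) ^ 2 + Fintype.card F + 1) * rankWeight w 1 +
        Fintype.card F * ((Fintype.card F : ℚ) ^ 2 + Fintype.card F + 1) * rankWeight w 2 -
          (Fintype.card F : ℚ) ^ 3 * rankWeight w 3) := by
  have hq := card_rat_ge_two (F := F)
  have h1 : (Fintype.card F : ℚ) - 1 ≠ 0 := by linarith
  have h2 : (Fintype.card F : ℚ) ^ 2 - 1 ≠ 0 := by nlinarith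
  have h3 : (Fintype.card F : ℚ) ^ 3 - 1 ≠ 0 := by
    have := one_lt_pow₀ (by linarith : (1 : ℚ) < Fintype.card F) (by norm_num : 3 ≠ 0)
    linarith
  simp [degeneracyCoeff, qBinomial, Finset.sum_range_succ, Finset.prod_range_succ,
    rankWeight_zero hw_zero]
  field_simp
  ring

/-- The character sum of a weight over the `3 × j` matrices. -/
noncomputable def weightTransform (w : Matrix (Fin 3) (Fin 3) F → ℕ) (χ : AddChar F ℂ) (j : ℕ) :
    ℂ :=
  ∑ z : Matrix (Fin 3) (Fin j) F, traceChar χ j z * (rankWeight w z.rank : ℂ)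

/-- The explicit rank sums of the trace character show that the transform is c_j up to a nonzero
factor: -1, 1 / q and -1 / q ^ 3 times c_j for j = 1, 2, 3. -/
lemma weightTransform_ne_zero {w : Matrix (Fin 3) (Fin 3) F → ℕ} (hw_zero : w 0 = 0)
    {χ : AddChar F ℂ} (hχ : χ ≠ 1) (hnd : Nondegenerate w) {j : ℕ} (h1 : 1 ≤ j) (h3 : j ≤ 3) :
    weightTransform w χ j ≠ 0 := by
  have hj := hnd j h1 h3
  intro h
  rw [weightTransform, sum_mul_rank _ fun i => (rankWeight w i : ℂ)] at h
  apply hj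
  interval_cases j
  · simp only [Finset.sum_range_succ, Finset.sum_range_zero, rankWeight_zero hw_zero,
      rankSum_traceChar_one hχ] at h
    rw [degeneracyCoeff_one hw_zero]
    simpa using h
  · simp only [Finset.sum_range_succ, Finset.sum_range_zero, rankWeight_zero hw_zero,
      rankSum_traceChar_two hχ] at h
    rw [degeneracyCoeff_two hw_zero]
    have h' : (-(Fintype.card F + 1) * rankWeight w 1 + Fintype.card F * rankWeight w 2 : ℚ) = 0 := by
      have : ((-(Fintype.card F + 1) * rankWeight w 1 + Fintype.card F * rankWeight w 2 : ℚ) : ℂ)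
          = 0 := by
        push_cast; linear_combination h
      exact_mod_cast this
    rw [h', mul_zero]
  · simp only [Finset.sum_range_succ, Finset.sum_range_zero, rankWeight_zero hw_zero,
      rankSum_traceChar_three hχ] at h
    rw [degeneracyCoeff_three hw_zero]
    have h' : (-((Fintype.card F : ℚ) ^ 2 + Fintype.card F + 1) * rankWeight w 1 +
        Fintype.card F * ((Fintype.card F : ℚ) ^ 2 + Fintype.card F + 1) * rankWeight w 2 -
          (Fintype.card F : ℚ) ^ 3 * rankWeight w 3) = 0 := by
      have : ((-((Fintype.card F : ℚ) ^ 2 + Fintype.card F + 1) * rankWeight w 1 +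
        Fintype.card F * ((Fintype.card F : ℚ) ^ 2 + Fintype.card F + 1) * rankWeight w 2 -
          (Fintype.card F : ℚ) ^ 3 * rankWeight w 3 : ℚ) : ℂ) = 0 := by
        push_cast; linear_combination h
      exact_mod_cast this
    rw [h', mul_zero]

-- If y is injective, then y * zᵀ has the rank of z and the sum is the transform. Otherwise a kernel
-- vector u of y allows z to be shifted by `vecMulVec c u` without changing the weight, while the
-- character acquires a factor other than 1.
open Classical in
lemma sum_traceChar_mul_weight {w : Matrix (Fin 3) (Fin 3) F → ℕ} (hw : MaximalSymmetry w)
    {χ : AddChar F ℂ} (hχ : χ ≠ 1) {j : ℕ} (hj : j ≤ 3) (y : Matrix (Fin 3) (Fin j) F) :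
    ∑ z : Matrix (Fin 3) (Fin j) F, traceChar χ j z * (w (y * zᵀ) : ℂ) =
      if ∀ v, y *ᵥ v = 0 → v = 0 then weightTransform w χ j else 0 := by
  split_ifs with hy
  · rw [weightTransform]
    refine Finset.sum_congr rfl fun z _ => ?_
    rw [hw.eq_rankWeight, rank_mul_eq_of_injective _ _ hy, rank_transpose]
  · push Not at hy
    obtain ⟨u, hyu, hu⟩ := hy
    have hG : colIncl F 3 j *ᵥ u ≠ 0 := fun h => hu (colIncl_mulVec_injective hj u h)
    obtain ⟨c, hc⟩ := exists_addChar_dotProduct_ne_one hχ hG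
    refine sum_eq_zero_of_shift _ (vecMulVec c u) _ hc fun z => ?_
    have h1 : y * (z + vecMulVec c u)ᵀ = y * zᵀ := by
      rw [transpose_add, transpose_vecMulVec, Matrix.mul_add, mul_vecMulVec, hyu]
      ext; simp
    rw [h1, traceChar, transpose_add, Matrix.add_mul, trace_add, AddChar.map_add_eq_mul,
      transpose_vecMulVec, trace_vecMulVec_mul, traceChar]
    ring

end RankWeights

/-! ### Nondegenerate weights generate all left invariant functions -/

section Surjectivity

variable {F : Type*} [Field F] [Fintype F] {ι : Type*} [Fintype ι] [DecidableEq ι]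

open Classical in
/-- A functional that kills all the weight functions of a nondegenerate weight kills the indicator
functions of `{x | x * T is injective}`. -/
lemma sum_ite_injective_eq_zero {w : Matrix (Fin 3) (Fin 3) F → ℕ} (hw : MaximalSymmetry w)
    (hw_zero : w 0 = 0) (hnd : Nondegenerate w) {χ : AddChar F ℂ} (hχ : χ ≠ 1)
    (ψ : Matrix (Fin 3) ι F → ℂ)
    (hψ : ∀ l : Matrix ι (Fin 3) F, ∑ x, ψ x * (w (x * l) : ℂ) = 0)
    {j : ℕ} (h1 : 1 ≤ j) (h3 : j ≤ 3) (T : Matrix ι (Fin j) F) :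
    ∑ x, ψ x * (if ∀ v, (x * T) *ᵥ v = 0 → v = 0 then 1 else 0) = 0 := by
  -- The functional is tested on the blocks l = T * zᵀ. Summed over z against the trace character,
  -- their weight functions give the indicator times the transform.
  apply mul_left_cancel₀ (weightTransform_ne_zero hw_zero hχ hnd h1 h3)
  have h2 : ∀ x : Matrix (Fin 3) ι F,
      weightTransform w χ j * (ψ x * (if ∀ v, (x * T) *ᵥ v = 0 → v = 0 then 1 else 0)) =
        ∑ z : Matrix (Fin 3) (Fin j) F, traceChar χ j z * (ψ x * (w (x * (T * zᵀ)) : ℂ)) := by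
    intro x
    have := sum_traceChar_mul_weight hw hχ h3 (x * T)
    rw [mul_left_comm, mul_ite, mul_one, mul_zero, ← this, Finset.mul_sum]
    refine Finset.sum_congr rfl fun z _ => ?_
    rw [Matrix.mul_assoc]; ring
  rw [Finset.mul_sum, Finset.sum_congr rfl fun x _ => h2 x, Finset.sum_comm, mul_zero]
  refine Finset.sum_eq_zero fun z _ => ?_
  rw [← Finset.mul_sum, hψ, mul_zero]

open Classical in
/-- The number of `3 × j` matrices `T` with `y * T` injective. -/
noncomputable def injCount (j : ℕ) (y : Matrix (Fin 3) (Fin 3) F) : ℂ :=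
  ∑ T : Matrix (Fin 3) (Fin j) F, if ∀ v, (y * T) *ᵥ v = 0 → v = 0 then 1 else 0

lemma injCount_mul_mul (j : ℕ) (U V : (Matrix (Fin 3) (Fin 3) F)ˣ) (y : Matrix (Fin 3) (Fin 3) F) :
    injCount j ((U : Matrix (Fin 3) (Fin 3) F) * y * (V : Matrix (Fin 3) (Fin 3) F)) =
      injCount j y := by
  classical
  rw [injCount, injCount, ← sum_unit_mul V fun T => if ∀ v, (y * T) *ᵥ v = 0 → v = 0 then (1 : ℂ)
    else 0]
  refine Finset.sum_congr rfl fun T _ => ?_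
  simp only [mulVec_injective_iff_rank_eq]
  rw [Matrix.mul_assoc, Matrix.mul_assoc, rank_unit_mul]

lemma injCount_eq (j : ℕ) (y : Matrix (Fin 3) (Fin 3) F) :
    injCount j y = injCount j (rankMatrix F 3 y.rank) := by
  obtain ⟨U, V, h⟩ := exists_units_mul_mul_eq_of_rank_eq (rankMatrix F 3 y.rank) y
    (rank_rankMatrix y.rank_le_width)
  conv_lhs => rw [← h]
  exact injCount_mul_mul j U V _

lemma injCount_eq_zero {j : ℕ} {y : Matrix (Fin 3) (Fin 3) F} (h : y.rank < j) :
    injCount j y = 0 := by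
  classical
  refine Finset.sum_eq_zero fun T _ => if_neg ?_
  rw [mulVec_injective_iff_rank_eq, Fintype.card_fin]
  have := rank_mul_le_left y T
  omega

lemma rankMatrix_mul_colIncl (j : ℕ) : rankMatrix F 3 j * colIncl F 3 j = colIncl F 3 j := by
  ext i k
  rw [rankMatrix, diagonal_mul]
  simp only [colIncl, of_apply]
  split_ifs with h1 h2 h2 <;> simp
  omega

lemma injCount_rankMatrix_self_ne_zero {j : ℕ} (hj : j ≤ 3) :
    injCount j (rankMatrix F 3 j) ≠ 0 := by
  classical
  rw [injCount, Finset.sum_boole, Nat.cast_ne_zero, Finset.card_ne_zero]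
  refine ⟨colIncl F 3 j, ?_⟩
  simp only [Finset.mem_filter, Finset.mem_univ, true_and, rankMatrix_mul_colIncl]
  exact fun v hv => colIncl_mulVec_injective hj v hv

/-- The function `injCount j` vanishes below rank j and not at rank j. The system for the
coefficients is therefore triangular and is solved by forward substitution. -/
lemma exists_eq_sum_injCount (b : ℕ → ℂ) (hb : b 0 = 0) :
    ∃ k₁ k₂ k₃ : ℂ, ∀ y : Matrix (Fin 3) (Fin 3) F,
      b y.rank = k₁ * injCount 1 y + k₂ * injCount 2 y + k₃ * injCount 3 y := by
  have h1 := injCount_rankMatrix_self_ne_zero (F := F) (j := 1) (by norm_num)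
  have h2 := injCount_rankMatrix_self_ne_zero (F := F) (j := 2) (by norm_num)
  have h3 := injCount_rankMatrix_self_ne_zero (F := F) (j := 3) (by norm_num)
  have hz : ∀ i j, i ≤ 3 → i < j → injCount j (rankMatrix F 3 i) = 0 := fun i j hi hij =>
    injCount_eq_zero (by rw [rank_rankMatrix hi]; exact hij)
  set k₁ := b 1 / injCount 1 (rankMatrix F 3 1)
  set k₂ := (b 2 - k₁ * injCount 1 (rankMatrix F 3 2)) / injCount 2 (rankMatrix F 3 2)
  set k₃ := (b 3 - k₁ * injCount 1 (rankMatrix F 3 3) - k₂ * injCount 2 (rankMatrix F 3 3)) /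
    injCount 3 (rankMatrix F 3 3)
  have e1 : k₁ * injCount 1 (rankMatrix F 3 1) = b 1 := div_mul_cancel₀ _ h1
  have e2 : k₂ * injCount 2 (rankMatrix F 3 2) = b 2 - k₁ * injCount 1 (rankMatrix F 3 2) :=
    div_mul_cancel₀ _ h2
  have e3 : k₃ * injCount 3 (rankMatrix F 3 3) = b 3 - k₁ * injCount 1 (rankMatrix F 3 3) -
    k₂ * injCount 2 (rankMatrix F 3 3) := div_mul_cancel₀ _ h3
  refine ⟨k₁, k₂, k₃, fun y => ?_⟩
  rw [injCount_eq 1 y, injCount_eq 2 y, injCount_eq 3 y]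
  have hy : y.rank ≤ 3 := y.rank_le_width
  generalize y.rank = r at hy
  interval_cases r
  · rw [hz 0 1, hz 0 2, hz 0 3] <;> simp [hb]
  · rw [hz 1 2, hz 1 3, e1] <;> simp
  · rw [hz 2 3, e2] <;> simp
  · rw [e3]; ring

/-- Orthogonality of the characters `x ↦ χ (tr (x * l))`. -/
lemma sum_addChar_trace_eq_zero {χ : AddChar F ℂ} (hχ : χ ≠ 1) {x : Matrix (Fin 3) ι F}
    (hx : x ≠ 0) : ∑ l : Matrix ι (Fin 3) F, χ (x * l).trace = 0 := by
  obtain ⟨a, ha⟩ := AddChar.ne_one_iff.1 hχ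
  obtain ⟨i, j, hij⟩ : ∃ i j, x i j ≠ 0 := by
    by_contra! hc
    exact hx (by ext i j; exact hc i j)
  refine sum_eq_zero_of_shift _ (Matrix.single j i (a / x i j)) (χ a) ha fun l => ?_
  rw [Matrix.mul_add, trace_add, AddChar.map_add_eq_mul]
  congr 2
  rw [trace_mul_single]
  exact mul_div_cancel₀ _ hij

/-- A left invariant functional that kills all the weight functions of a nondegenerate weight is
concentrated at zero. -/
lemma eq_zero_of_sum_mul_weight_eq_zero {w : Matrix (Fin 3) (Fin 3) F → ℕ}
    (hw : MaximalSymmetry w) (hw_zero : w 0 = 0) (hnd : Nondegenerate w)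
    (ψ : Matrix (Fin 3) ι F → ℂ)
    (hψ : ∀ l : Matrix ι (Fin 3) F, ∑ x, ψ x * (w (x * l) : ℂ) = 0)
    (hinv : ∀ (U : (Matrix (Fin 3) (Fin 3) F)ˣ) x, ψ ((U : Matrix (Fin 3) (Fin 3) F) * x) = ψ x)
    {x₀ : Matrix (Fin 3) ι F} (hx₀ : x₀ ≠ 0) : ψ x₀ = 0 := by
  classical
  obtain ⟨χ, hχ'⟩ := AddChar.exists_apply_ne_zero.2 (one_ne_zero (α := F))
  have hχ : χ ≠ 1 := AddChar.ne_one_iff.2 ⟨1, hχ'⟩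
  let κ : Matrix (Fin 3) (Fin 3) F → ℂ := fun y =>
    ∑ g : (Matrix (Fin 3) (Fin 3) F)ˣ, χ ((g : Matrix (Fin 3) (Fin 3) F) * y).trace
  have hκ : ∀ y, κ y = κ (rankMatrix F 3 y.rank) := by
    intro y
    obtain ⟨U, V, h⟩ := exists_units_mul_mul_eq_of_rank_eq (rankMatrix F 3 y.rank) y
      (rank_rankMatrix y.rank_le_width)
    conv_lhs => rw [← h]
    simp only [κ]
    -- Reindexing by g ↦ V * g * U matches the cyclic invariance of the trace.
    rw [← Equiv.sum_comp ((Equiv.mulLeft V).trans (Equiv.mulRight U)) fun g =>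
      χ ((g : Matrix (Fin 3) (Fin 3) F) * rankMatrix F 3 y.rank).trace]
    refine Finset.sum_congr rfl fun g _ => ?_
    simp only [Equiv.trans_apply, Equiv.coe_mulLeft, Equiv.coe_mulRight, Units.val_mul]
    rw [← Matrix.mul_assoc, trace_mul_comm, ← Matrix.mul_assoc, ← Matrix.mul_assoc]
  have hinj : ∀ j, 1 ≤ j → j ≤ 3 → ∀ l : Matrix ι (Fin 3) F,
      ∑ x, ψ x * injCount j (x * l) = 0 := by
    intro j h1 h3 l
    simp only [injCount, Finset.mul_sum]
    rw [Finset.sum_comm]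
    refine Finset.sum_eq_zero fun T _ => ?_
    simp only [Matrix.mul_assoc]
    have := sum_ite_injective_eq_zero hw hw_zero hnd hχ ψ hψ h1 h3 (l * T)
    simpa only [Matrix.mul_assoc] using this
  obtain ⟨k₁, k₂, k₃, hk⟩ := exists_eq_sum_injCount (F := F)
    (fun i => κ (rankMatrix F 3 i) - κ 0) (by simp [rankMatrix])
  have hsum : ∀ l : Matrix ι (Fin 3) F, ∑ x, ψ x * κ (x * l) = ∑ x, ψ x * κ 0 := by
    intro l
    rw [← sub_eq_zero, ← Finset.sum_sub_distrib]
    have : ∀ x, ψ x * κ (x * l) - ψ x * κ 0 = k₁ * (ψ x * injCount 1 (x * l)) +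
        k₂ * (ψ x * injCount 2 (x * l)) + k₃ * (ψ x * injCount 3 (x * l)) := by
      intro x
      have := hk (x * l)
      simp only [← hκ] at this
      linear_combination ψ x * this
    simp only [this, Finset.sum_add_distrib, ← Finset.mul_sum]
    rw [hinj 1, hinj 2, hinj 3] <;> norm_num
  have hG : (Fintype.card (Matrix (Fin 3) (Fin 3) F)ˣ : ℂ) ≠ 0 := by
    exact_mod_cast Fintype.card_ne_zero
  -- Left invariance removes the average over units in κ. The Fourier transform of ψ is thus
  -- constant, and Fourier inversion puts ψ at zero.
  have hF : ∀ l : Matrix ι (Fin 3) F, ∑ x, ψ x * χ (x * l).trace = ∑ x, ψ x := by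
    intro l
    apply mul_left_cancel₀ hG
    have h1 : ∑ x, ψ x * κ (x * l) = Fintype.card (Matrix (Fin 3) (Fin 3) F)ˣ *
        ∑ x, ψ x * χ (x * l).trace := by
      simp only [κ, Finset.mul_sum]
      rw [Finset.sum_comm]
      rw [Finset.sum_congr rfl (g := fun _ => ∑ x, ψ x * χ (x * l).trace)]
      · simp [Finset.mul_sum]
      · intro g _
        rw [← sum_unit_mul g fun x => ψ x * χ (x * l).trace]
        refine Finset.sum_congr rfl fun x _ => ?_
        simp only [hinv, Matrix.mul_assoc]
    rw [← h1, hsum l]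
    simp [κ, ← Finset.sum_mul, mul_comm]
  have h0 : ∑ l : Matrix ι (Fin 3) F, χ (-x₀ * l).trace * ∑ x, ψ x * χ (x * l).trace =
      Fintype.card (Matrix ι (Fin 3) F) * ψ x₀ := by
    simp only [Finset.mul_sum]
    rw [Finset.sum_comm, Finset.sum_eq_single x₀]
    · have : ∀ l : Matrix ι (Fin 3) F, χ (-x₀ * l).trace * (ψ x₀ * χ (x₀ * l).trace) = ψ x₀ := by
        intro l
        rw [mul_left_comm, ← AddChar.map_add_eq_mul, ← trace_add, ← Matrix.add_mul]
        simp
      simp only [this]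
      simp
    · intro x _ hx
      have : ∀ l : Matrix ι (Fin 3) F, χ (-x₀ * l).trace * (ψ x * χ (x * l).trace) =
          ψ x * χ ((x - x₀) * l).trace := by
        intro l
        rw [mul_left_comm, ← AddChar.map_add_eq_mul, ← trace_add, ← Matrix.add_mul,
          neg_add_eq_sub]
      simp only [this, ← Finset.mul_sum]
      rw [sum_addChar_trace_eq_zero hχ (sub_ne_zero.2 hx), mul_zero]
    · simp
  simp only [hF, ← Finset.sum_mul] at h0
  rw [sum_addChar_trace_eq_zero hχ (neg_ne_zero.2 hx₀), zero_mul] at h0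
  have hL : (Fintype.card (Matrix ι (Fin 3) F) : ℂ) ≠ 0 := by
    exact_mod_cast Fintype.card_ne_zero
  exact (mul_eq_zero.1 h0.symm).resolve_left hL

/-- For a nondegenerate weight, every left invariant function vanishing at zero is a rational
combination of weight functions. -/
lemma exists_sum_mul_weight_eq {w : Matrix (Fin 3) (Fin 3) F → ℕ}
    (hw : MaximalSymmetry w) (hw_zero : w 0 = 0) (hnd : Nondegenerate w)
    (s : Matrix (Fin 3) ι F → ℚ) (hs0 : s 0 = 0)
    (hs : ∀ (U : (Matrix (Fin 3) (Fin 3) F)ˣ) x, s ((U : Matrix (Fin 3) (Fin 3) F) * x) = s x) :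
    ∃ η : Matrix ι (Fin 3) F → ℚ, ∀ x, s x = ∑ l, η l * (w (x * l) : ℚ) := by
  classical
  refine exists_combination (fun l x => (w (x * l) : ℚ)) s fun ψ hψ => ?_
  -- On left invariant functions ψ and its average over the units agree up to the order of the unit
  -- group, so the average may replace ψ.
  let ψ' : Matrix (Fin 3) ι F → ℚ := fun x =>
    ∑ g : (Matrix (Fin 3) (Fin 3) F)ˣ, ψ ((g : Matrix (Fin 3) (Fin 3) F) * x)
  have hψ' : ∀ f : Matrix (Fin 3) ι F → ℚ,
      (∀ (U : (Matrix (Fin 3) (Fin 3) F)ˣ) x, f ((U : Matrix (Fin 3) (Fin 3) F) * x) = f x) →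
      ∑ x, ψ' x * f x = Fintype.card (Matrix (Fin 3) (Fin 3) F)ˣ * ∑ x, ψ x * f x := by
    intro f hf
    simp only [ψ', Finset.sum_mul]
    rw [Finset.sum_comm, Finset.sum_congr rfl (g := fun _ => ∑ x, ψ x * f x)]
    · simp
    · intro g _
      rw [← sum_unit_mul g fun x => ψ x * f x]
      simp only [hf]
  have hz : ∀ x, x ≠ 0 → ψ' x = 0 := by
    intro x hx
    have := eq_zero_of_sum_mul_weight_eq_zero hw hw_zero hnd (fun x => (ψ' x : ℂ)) (fun l => by
      have h1 := hψ' (fun x => (w (x * l) : ℚ)) (fun U x => by rw [Matrix.mul_assoc, hw.1])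
      rw [hψ l, mul_zero] at h1
      exact_mod_cast h1) (fun U x => by
        simp only [ψ']
        congr 1
        rw [← Equiv.sum_comp (Equiv.mulRight U) fun g =>
          ψ ((g : Matrix (Fin 3) (Fin 3) F) * x)]
        simp [Matrix.mul_assoc]) hx
    exact_mod_cast this
  have h1 := hψ' s hs
  rw [Finset.sum_eq_zero] at h1
  · have hG : (Fintype.card (Matrix (Fin 3) (Fin 3) F)ˣ : ℚ) ≠ 0 := by
      exact_mod_cast Fintype.card_ne_zero
    exact (mul_eq_zero.1 h1.symm).resolve_left hG
  · intro x _
    by_cases hx : x = 0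
    · rw [hx, hs0, mul_zero]
    · rw [hz x hx, zero_mul]

end Surjectivity

/-! ### The dual count as an integral of weights against a rank kernel -/

section Kernel

variable {F : Type*} [Field F] [Fintype F] {ι : Type*} [Fintype ι] [DecidableEq ι]
  {w : Matrix (Fin 3) (Fin 3) F → ℕ}

lemma dualCount_unit_mul (t : ℕ) (V : (Matrix ι ι F)ˣ) (l : Matrix ι (Fin 3) F) :
    dualCount w t ((V : Matrix ι ι F) * l) = dualCount w t l := by
  rw [dualCount, dualCount]
  refine Nat.card_congr (Equiv.subtypeEquivRight fun r => and_congr_right fun _ => ?_)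
  constructor
  · intro h
    have := congrArg (fun z => ((V⁻¹ : (Matrix ι ι F)ˣ) : Matrix ι ι F) * z) h
    simpa [← Matrix.mul_assoc] using this
  · intro h
    rw [Matrix.mul_assoc, h, Matrix.mul_zero]

/-- If the weight respects duality, the number of dual words is an integral of the weight functions
against a kernel depending on the rank only. -/
lemma RespectsDuality.exists_rank_kernel (h : RespectsDuality w) (hw : MaximalSymmetry w)
    (hw_zero : w 0 = 0) (hw_pos : ∀ r, r ≠ 0 → 0 < w r)
    {t : ℕ} (ht : 0 < t) (hsingle : ∀ r s, r ≠ 0 → s ≠ 0 → t < w r + w s) :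
    ∃ γ : ℕ → ℚ, ∀ l : Matrix ι (Fin 3) F,
      (dualCount w t l : ℚ) - dualCount w t (0 : Matrix ι (Fin 3) F) =
        ∑ x : Matrix (Fin 3) ι F, γ x.rank * (w (x * l) : ℚ) := by
  classical
  obtain ⟨g, hg⟩ := exists_combination (K := ℚ)
    (fun (x : Matrix (Fin 3) ι F) (l : Matrix ι (Fin 3) F) => (w (x * l) : ℚ))
    (fun l => (dualCount w t l : ℚ) - dualCount w t (0 : Matrix ι (Fin 3) F)) (fun η hη => by
      -- With S = S' = ∅ the swap relation says that a combination on which all weights vanish also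
      -- annihilates the dual count. This is the hypothesis of the double annihilator lemma.
      have := h.sum_mul_dualCount_sub_eq_zero hw_zero hw_pos (fun _ => 1) (fun _ => le_rfl)
        (S := (∅ : Finset (Matrix (Fin 3) ι F))) (S' := ∅) (by simp) rfl 0 (by simp) η (fun _ => 0)
        (fun x => by simpa using hη x) (by simp) ht hsingle
      simpa using this)
  let G : Matrix (Fin 3) ι F → ℚ := fun x =>
    ∑ U : (Matrix (Fin 3) (Fin 3) F)ˣ, ∑ V : (Matrix ι ι F)ˣ,
      g ((U : Matrix (Fin 3) (Fin 3) F) * (x * (V : Matrix ι ι F)))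
  have hG : ∀ x y : Matrix (Fin 3) ι F, x.rank = y.rank → G x = G y := by
    intro x y hxy
    obtain ⟨U, V, rfl⟩ := exists_units_mul_mul_eq_of_rank_eq x y hxy
    simp only [G]
    rw [← Equiv.sum_comp (Equiv.mulRight U)]
    refine Finset.sum_congr rfl fun U' _ => ?_
    rw [← Equiv.sum_comp (Equiv.mulLeft V)]
    refine Finset.sum_congr rfl fun V' _ => ?_
    simp [Matrix.mul_assoc]
  set c : ℚ := Fintype.card (Matrix (Fin 3) (Fin 3) F)ˣ * Fintype.card (Matrix ι ι F)ˣ with hc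
  have hc0 : c ≠ 0 := mul_ne_zero (by exact_mod_cast Fintype.card_ne_zero)
    (by exact_mod_cast Fintype.card_ne_zero)
  have hsum : ∀ l : Matrix ι (Fin 3) F, ∑ x, G x * (w (x * l) : ℚ) =
      c * ((dualCount w t l : ℚ) - dualCount w t (0 : Matrix ι (Fin 3) F)) := by
    intro l
    simp only [G, Finset.sum_mul]
    rw [Finset.sum_comm, Finset.sum_congr rfl fun U _ => Finset.sum_comm,
      Finset.sum_congr rfl fun U _ => Finset.sum_congr rfl (g := fun _ =>
        ((dualCount w t l : ℚ) - dualCount w t (0 : Matrix ι (Fin 3) F))) fun V _ => ?_]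
    · simp only [Finset.sum_const, nsmul_eq_mul, Finset.card_univ, hc]
      ring
    · have h1 := hg (((V⁻¹ : (Matrix ι ι F)ˣ) : Matrix ι ι F) * l)
      rw [dualCount_unit_mul, ← sum_unit_mul U, ← sum_mul_unit V] at h1
      rw [h1]
      refine Finset.sum_congr rfl fun x _ => ?_
      have h2 : (U : Matrix (Fin 3) (Fin 3) F) * (x * (V : Matrix ι ι F)) *
          (((V⁻¹ : (Matrix ι ι F)ˣ) : Matrix ι ι F) * l) =
            (U : Matrix (Fin 3) (Fin 3) F) * (x * l) := by
        rw [Matrix.mul_assoc, Matrix.mul_assoc x, ← Matrix.mul_assoc (V : Matrix ι ι F),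
          Units.mul_inv, Matrix.one_mul]
      rw [h2, hw.1]
  -- The value at ranks that do not occur is immaterial and set to 0.
  refine ⟨fun r => if hr : ∃ x : Matrix (Fin 3) ι F, x.rank = r then G hr.choose / c else 0,
    fun l => ?_⟩
  apply mul_left_cancel₀ hc0
  rw [← hsum, Finset.mul_sum]
  refine Finset.sum_congr rfl fun x _ => ?_
  have hx : ∃ y : Matrix (Fin 3) ι F, y.rank = x.rank := ⟨x, rfl⟩
  simp only [dif_pos hx]
  rw [hG _ _ hx.choose_spec]
  field_simp

end Kernel

/-! ### Equinumerous sets of consecutive ranks -/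

section SwapSets

variable {F : Type*} [Field F] [Fintype F]

/-- The column index set used for the swapped codes. -/
abbrev Cols : Type := (Fin 3 ⊕ Fin 3) ⊕ Fin 3

/-- Row spaces that meet the first two blocks of columns only. -/
def lowBasis {r : ℕ} (Y : Matrix (Fin r) (Fin 3) F) : Matrix (Fin r) Cols F :=
  fromCols (fromCols (colIncl F 3 r)ᵀ Y) 0

/-- A row space contained in the last block of columns. -/
def highBasis (F : Type*) [Field F] (r : ℕ) : Matrix (Fin r) Cols F :=
  fromCols 0 (colIncl F 3 r)ᵀ

lemma colIncl_transpose_mul_colIncl {r : ℕ} (hr : r ≤ 3) :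
    (colIncl F 3 r)ᵀ * colIncl F 3 r = 1 := by
  ext i j
  rw [mul_apply, Finset.sum_eq_single ⟨i, by omega⟩]
  · simp [colIncl, one_apply, Fin.ext_iff]
  · intro b _ hb
    simp only [colIncl, transpose_apply, of_apply]
    rw [if_neg, zero_mul]
    intro h; apply hb; ext; exact h
  · simp

lemma lowBasis_mul {r : ℕ} (hr : r ≤ 3) (Y : Matrix (Fin r) (Fin 3) F) :
    lowBasis Y * (fromRows (fromRows (colIncl F 3 r) 0) 0 : Matrix Cols (Fin r) F) = 1 := by
  simp [lowBasis, fromCols_mul_fromRows, colIncl_transpose_mul_colIncl hr]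

lemma highBasis_mul {r : ℕ} (hr : r ≤ 3) :
    highBasis F r * (fromRows 0 (colIncl F 3 r) : Matrix Cols (Fin r) F) = 1 := by
  simp [highBasis, fromCols_mul_fromRows, colIncl_transpose_mul_colIncl hr]

lemma rank_mul_eq_left_of_mul_eq_one {m n l : Type*} [Fintype m] [Fintype n] [Fintype l]
    [DecidableEq n] (a : Matrix m n F) {B : Matrix n l F} {C : Matrix l n F} (h : B * C = 1) :
    (a * B).rank = a.rank := by
  refine le_antisymm (rank_mul_le_left _ _) ?_
  calc a.rank = (a * B * C).rank := by rw [Matrix.mul_assoc, h, Matrix.mul_one]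
    _ ≤ _ := rank_mul_le_left _ _

lemma mul_left_cancel_of_rank_eq {r : ℕ} {n : Type*} [Fintype n] {a : Matrix (Fin 3) (Fin r) F}
    (ha : a.rank = r) {X Y : Matrix (Fin r) n F} (h : a * X = a * Y) : X = Y := by
  rw [← sub_eq_zero]
  ext i j
  have h1 : a *ᵥ (X - Y).col j = 0 := by
    have : a * (X - Y) = 0 := by rw [Matrix.mul_sub, h, sub_self]
    ext k
    exact congrFun (congrFun this k) j
  have := (mulVec_injective_iff_rank_eq a).2 (by simpa using ha) _ h1
  exact congrFun this i

lemma card_rank_eq_succ {r : ℕ} (hr : r < 3) :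
    (Finset.univ.filter fun a : Matrix (Fin 3) (Fin (r + 1)) F => a.rank = r + 1).card =
      (Finset.univ.filter fun a : Matrix (Fin 3) (Fin r) F => a.rank = r).card *
        (Fintype.card F ^ 3 - Fintype.card F ^ r) := by
  have h : ∀ a, ((Finset.univ.filter fun z : Matrix (Fin 3) (Fin a) F => z.rank = a).card : ℚ) =
      rankCount F a a := by
    intro a; simp [rankCount, rankSum]
  have h2 : rankCount F (r + 1) (r + 1) = rankCount F r r *
      ((Fintype.card F : ℚ) ^ 3 - (Fintype.card F : ℚ) ^ r) := by
    rw [rankCount_self F (by omega), rankCount_self F (by omega), Fin.prod_univ_castSucc]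
    simp
  rw [← h, ← h] at h2
  have h3 : Fintype.card F ^ r ≤ Fintype.card F ^ 3 :=
    Nat.pow_le_pow_right Fintype.card_pos (by omega)
  have : (((Finset.univ.filter fun a : Matrix (Fin 3) (Fin (r + 1)) F =>
      a.rank = r + 1).card : ℕ) : ℚ) =
      (((Finset.univ.filter fun a : Matrix (Fin 3) (Fin r) F => a.rank = r).card *
        (Fintype.card F ^ 3 - Fintype.card F ^ r) : ℕ) : ℚ) := by
    rw [h2]
    push_cast [Nat.cast_sub h3]
    ring
  exact_mod_cast this

open Classical in
/-- The matrices of full column rank times a row basis from `Z`. -/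
noncomputable def lowSet {r : ℕ} (Z : Finset (Matrix (Fin r) (Fin 3) F)) :
    Finset (Matrix (Fin 3) Cols F) :=
  ((Finset.univ.filter fun a : Matrix (Fin 3) (Fin r) F => a.rank = r) ×ˢ Z).image
    fun p => p.1 * lowBasis p.2

open Classical in
/-- The matrices whose row space is that of `highBasis`. -/
noncomputable def highSet (F : Type*) [Field F] [Fintype F] (r : ℕ) :
    Finset (Matrix (Fin 3) Cols F) :=
  (Finset.univ.filter fun a : Matrix (Fin 3) (Fin r) F => a.rank = r).image
    fun a => a * highBasis F r

lemma mem_lowSet {r : ℕ} {Z : Finset (Matrix (Fin r) (Fin 3) F)} {x : Matrix (Fin 3) Cols F} :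
    x ∈ lowSet Z ↔ ∃ a : Matrix (Fin 3) (Fin r) F, ∃ Y ∈ Z, a.rank = r ∧ x = a * lowBasis Y := by
  simp only [lowSet, Finset.mem_image, Finset.mem_product, Finset.mem_filter, Finset.mem_univ,
    true_and, Prod.exists]
  constructor
  · rintro ⟨a, Y, ⟨ha, hY⟩, rfl⟩; exact ⟨a, Y, hY, ha, rfl⟩
  · rintro ⟨a, Y, hY, ha, rfl⟩; exact ⟨a, Y, ⟨ha, hY⟩, rfl⟩

lemma mem_highSet {r : ℕ} {x : Matrix (Fin 3) Cols F} :
    x ∈ highSet F r ↔ ∃ a : Matrix (Fin 3) (Fin r) F, a.rank = r ∧ x = a * highBasis F r := by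
  simp [highSet, eq_comm]

/-- The factorisation a * `lowBasis Y` is unique: a right inverse of the basis, independent of Y,
recovers a, and cancelling a of full column rank recovers Y. -/
lemma card_lowSet {r : ℕ} (hr : r ≤ 3) (Z : Finset (Matrix (Fin r) (Fin 3) F)) :
    (lowSet Z).card =
      (Finset.univ.filter fun a : Matrix (Fin 3) (Fin r) F => a.rank = r).card * Z.card := by
  classical
  rw [lowSet, Finset.card_image_of_injOn, Finset.card_product]
  rintro ⟨a, Y⟩ haY ⟨a', Y'⟩ haY' h
  simp only [Finset.coe_product, Set.mem_prod, Finset.mem_coe, Finset.mem_filter, Finset.mem_univ,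
    true_and] at haY haY'
  have h1 : a = a' := by
    have := congrArg (fun z => z * (fromRows (fromRows (colIncl F 3 r) 0) 0 : Matrix Cols (Fin r) F)) h
    simpa [Matrix.mul_assoc, lowBasis_mul hr] using this
  subst h1
  have h2 := mul_left_cancel_of_rank_eq haY.1 h
  simp only [lowBasis, fromCols_inj.eq_iff] at h2
  have h3 : Y = Y' := by simpa using h2
  rw [h3]

lemma card_highSet {r : ℕ} (hr : r ≤ 3) : (highSet F r).card =
    (Finset.univ.filter fun a : Matrix (Fin 3) (Fin r) F => a.rank = r).card := by
  classical
  rw [highSet, Finset.card_image_of_injOn]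
  intro a _ a' _ h
  have := congrArg (fun z => z * (fromRows 0 (colIncl F 3 r) : Matrix Cols (Fin r) F)) h
  simpa [Matrix.mul_assoc, highBasis_mul hr] using this

lemma rank_of_mem_lowSet {r : ℕ} (hr : r ≤ 3) {Z : Finset (Matrix (Fin r) (Fin 3) F)}
    {x : Matrix (Fin 3) Cols F} (hx : x ∈ lowSet Z) : x.rank = r := by
  obtain ⟨a, Y, -, ha, rfl⟩ := mem_lowSet.1 hx
  rw [rank_mul_eq_left_of_mul_eq_one a (lowBasis_mul hr Y), ha]

lemma rank_of_mem_highSet {r : ℕ} (hr : r ≤ 3)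
    {x : Matrix (Fin 3) Cols F} (hx : x ∈ highSet F r) : x.rank = r := by
  obtain ⟨a, ha, rfl⟩ := mem_highSet.1 hx
  rw [rank_mul_eq_left_of_mul_eq_one a (highBasis_mul hr), ha]

lemma mul_eq_of_units_mul {n : Type*} [Fintype n] (U : (Matrix (Fin 3) (Fin 3) F)ˣ)
    {x y : Matrix (Fin 3) n F} (h : (U : Matrix (Fin 3) (Fin 3) F) * x = y) :
    x = ((U⁻¹ : (Matrix (Fin 3) (Fin 3) F)ˣ) : Matrix (Fin 3) (Fin 3) F) * y := by
  rw [← h, ← Matrix.mul_assoc, Units.inv_mul, Matrix.one_mul]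

lemma unit_mul_mem_lowSet {r : ℕ} {Z : Finset (Matrix (Fin r) (Fin 3) F)}
    (U : (Matrix (Fin 3) (Fin 3) F)ˣ) (x : Matrix (Fin 3) Cols F) :
    (U : Matrix (Fin 3) (Fin 3) F) * x ∈ lowSet Z ↔ x ∈ lowSet Z := by
  rw [mem_lowSet, mem_lowSet]
  constructor
  · rintro ⟨a, Y, hY, ha, h⟩
    exact ⟨_, Y, hY, (rank_unit_mul U⁻¹ a).trans ha, by
      rw [Matrix.mul_assoc]; exact mul_eq_of_units_mul U h⟩
  · rintro ⟨a, Y, hY, ha, rfl⟩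
    exact ⟨_, Y, hY, (rank_unit_mul U a).trans ha, by rw [Matrix.mul_assoc]⟩

lemma unit_mul_mem_highSet {r : ℕ}
    (U : (Matrix (Fin 3) (Fin 3) F)ˣ) (x : Matrix (Fin 3) Cols F) :
    (U : Matrix (Fin 3) (Fin 3) F) * x ∈ highSet F r ↔ x ∈ highSet F r := by
  rw [mem_highSet, mem_highSet]
  constructor
  · rintro ⟨a, ha, h⟩
    exact ⟨_, (rank_unit_mul U⁻¹ a).trans ha, by
      rw [Matrix.mul_assoc]; exact mul_eq_of_units_mul U h⟩
  · rintro ⟨a, ha, rfl⟩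
    exact ⟨_, (rank_unit_mul U a).trans ha, by rw [Matrix.mul_assoc]⟩

/-- The matrix whose product with `x` has the column `i` of `x` as its only nonzero column. -/
def probe (F : Type*) [Field F] {n : Type*} [DecidableEq n] (i : n) : Matrix n (Fin 3) F :=
  Matrix.single i 0 1

lemma mul_probe_eq_zero_iff {m n : Type*} [Fintype n] [DecidableEq n] (x : Matrix m n F) (i : n) :
    x * probe F i = 0 ↔ ∀ k, x k i = 0 := by
  constructor
  · intro h k
    have := congrFun (congrFun h k) 0
    simpa [probe] using this
  · intro h
    ext k j
    simp [probe, mul_apply, Matrix.single, h, ite_and]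

lemma weight_mul_probe {w : Matrix (Fin 3) (Fin 3) F → ℕ} (hw : MaximalSymmetry w)
    {n : Type*} [Fintype n] [DecidableEq n] {x : Matrix (Fin 3) n F} {i : n}
    (h : x * probe F i ≠ 0) :
    w (x * probe F i) = rankWeight w 1 := by
  rw [hw.eq_rankWeight]
  congr 1
  have h1 : (x * probe F i).rank ≤ 1 := by
    refine (rank_mul_le_right _ _).trans ?_
    rw [show probe F i =
      vecMulVec (Pi.single i 1) (Pi.single 0 1) by
        ext a b; simp [probe, Matrix.single, vecMulVec_apply, Pi.single_apply, ite_and, eq_comm]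
        split_ifs <;> rfl]
    exact rank_vecMulVec_le _ _
  have h2 : (x * probe F i).rank ≠ 0 := fun h0 => h ((rank_eq_zero_iff _).1 h0)
  omega

lemma rankWeight_pos {w : Matrix (Fin 3) (Fin 3) F → ℕ} (hw_pos : ∀ r, r ≠ 0 → 0 < w r) {i : ℕ}
    (h1 : 1 ≤ i) (h3 : i ≤ 3) : 0 < rankWeight w i := by
  refine hw_pos _ fun h => ?_
  have := rank_rankMatrix (F := F) h3
  rw [h, rank_zero] at this
  omega

/-- One probe sees the first column of a, which is nonzero, and the other looks into the last block
of columns, where everything vanishes. `weight_highSet` reverses the roles, so the two probes can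
adjust the weights of the two sets independently. -/
lemma weight_lowSet {w : Matrix (Fin 3) (Fin 3) F → ℕ} (hw : MaximalSymmetry w) (hw_zero : w 0 = 0)
    {r : ℕ} (h1 : 1 ≤ r) {Z : Finset (Matrix (Fin r) (Fin 3) F)}
    {x : Matrix (Fin 3) Cols F} (hx : x ∈ lowSet Z) :
    w (x * probe F (Sum.inl (Sum.inl 0) : Cols)) = rankWeight w 1 ∧
      w (x * probe F (Sum.inr 0 : Cols)) = 0 := by
  obtain ⟨a, Y, -, ha, rfl⟩ := mem_lowSet.1 hx
  constructor
  · refine weight_mul_probe hw fun h => ?_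
    rw [Matrix.mul_assoc] at h
    have := mul_left_cancel_of_rank_eq ha (h.trans (Matrix.mul_zero a).symm)
    have := (mul_probe_eq_zero_iff _ _).1 this ⟨0, h1⟩
    simp [lowBasis, colIncl] at this
  · rw [Matrix.mul_assoc, (mul_probe_eq_zero_iff (lowBasis Y) (Sum.inr 0)).2, Matrix.mul_zero,
      hw_zero]
    intro k; simp [lowBasis]

lemma weight_highSet {w : Matrix (Fin 3) (Fin 3) F → ℕ} (hw : MaximalSymmetry w)
    (hw_zero : w 0 = 0) {r : ℕ} (h1 : 1 ≤ r)
    {x : Matrix (Fin 3) Cols F} (hx : x ∈ highSet F r) :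
    w (x * probe F (Sum.inl (Sum.inl 0) : Cols)) = 0 ∧
      w (x * probe F (Sum.inr 0 : Cols)) = rankWeight w 1 := by
  obtain ⟨a, ha, rfl⟩ := mem_highSet.1 hx
  constructor
  · rw [Matrix.mul_assoc, (mul_probe_eq_zero_iff (highBasis F r) (Sum.inl (Sum.inl 0))).2,
      Matrix.mul_zero, hw_zero]
    intro k; simp [highBasis]
  · refine weight_mul_probe hw fun h => ?_
    rw [Matrix.mul_assoc] at h
    have := mul_left_cancel_of_rank_eq ha (h.trans (Matrix.mul_zero a).symm)
    have := (mul_probe_eq_zero_iff _ _).1 this ⟨0, h1⟩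
    simp [highBasis, colIncl] at this

lemma sum_weight_eq_of_rank_eq {w : Matrix (Fin 3) (Fin 3) F → ℕ} (hw : MaximalSymmetry w)
    {ι : Type*} [Fintype ι] [DecidableEq ι] {x y : Matrix (Fin 3) ι F} (h : x.rank = y.rank) :
    ∑ l : Matrix ι (Fin 3) F, w (x * l) = ∑ l : Matrix ι (Fin 3) F, w (y * l) := by
  obtain ⟨U, V, rfl⟩ := exists_units_mul_mul_eq_of_rank_eq x y h
  simp only [Matrix.mul_assoc, hw.1]
  exact (sum_unit_mul V fun l => w (x * l)).symm

/-- The rank kernel of a nondegenerate weight that respects duality takes the same value on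
consecutive ranks. -/
lemma RespectsDuality.kernel_succ {w : Matrix (Fin 3) (Fin 3) F → ℕ} (h : RespectsDuality w)
    (hw : MaximalSymmetry w) (hw_zero : w 0 = 0) (hw_pos : ∀ r, r ≠ 0 → 0 < w r)
    (hnd : Nondegenerate w) {t : ℕ} (ht : 0 < t)
    (hsingle : ∀ r s, r ≠ 0 → s ≠ 0 → t < w r + w s) (γ : ℕ → ℚ)
    (hγ : ∀ l : Matrix Cols (Fin 3) F,
      (dualCount w t l : ℚ) - dualCount w t (0 : Matrix Cols (Fin 3) F) =
        ∑ x : Matrix (Fin 3) Cols F, γ x.rank * (w (x * l) : ℚ))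
    {r : ℕ} (h1 : 1 ≤ r) (h3 : r < 3) : γ r = γ (r + 1) := by
  classical
  -- Passing from r to r + 1 multiplies the number of full-rank coefficient matrices by q ^ 3 - q ^
  -- r. That many row spaces of dimension r are needed to balance one of dimension r + 1, and the
  -- free block Y provides q ^ (3 * r) of them.
  obtain ⟨Z, -, hZ⟩ := Finset.exists_subset_card_eq
    (s := (Finset.univ : Finset (Matrix (Fin r) (Fin 3) F)))
    (n := Fintype.card F ^ 3 - Fintype.card F ^ r) (by
      rw [Finset.card_univ, card_matrix]
      exact (Nat.sub_le _ _).trans (Nat.pow_le_pow_right Fintype.card_pos (by omega)))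
  have hcard : (lowSet Z).card = (highSet F (r + 1)).card := by
    rw [card_lowSet h3.le, card_highSet h3, card_rank_eq_succ h3, hZ]
  have hpos : 0 < (highSet F (r + 1)).card := by
    rw [Finset.card_pos]
    refine ⟨colIncl F 3 (r + 1) * highBasis F (r + 1), mem_highSet.2 ⟨_, ?_, rfl⟩⟩
    have := (mulVec_injective_iff_rank_eq (colIncl F 3 (r + 1))).1
      fun v hv => colIncl_mulVec_injective h3 v hv
    simpa using this
  have hdisj : Disjoint (lowSet Z) (highSet F (r + 1)) := by
    rw [Finset.disjoint_left]
    intro x hx hx'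
    have e1 := rank_of_mem_lowSet h3.le hx
    have e2 := rank_of_mem_highSet h3 hx'
    omega
  have h0 : ∀ x : Matrix (Fin 3) Cols F, x.rank ≠ 0 → x ≠ 0 := by
    rintro x hx rfl; simp at hx
  obtain ⟨η, hη⟩ := exists_sum_mul_weight_eq hw hw_zero hnd
    (fun x => if x ∈ lowSet Z then (1 : ℚ) else 0)
    (if_neg fun hx => h0 _ (by rw [rank_of_mem_lowSet h3.le hx]; omega) rfl)
    (fun U x => by simp only [unit_mul_mem_lowSet])
  obtain ⟨η', hη'⟩ := exists_sum_mul_weight_eq hw hw_zero hnd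
    (fun x => if x ∈ highSet F (r + 1) then (1 : ℚ) else 0)
    (if_neg fun hx => h0 _ (by rw [rank_of_mem_highSet h3 hx]; omega) rfl)
    (fun U x => by simp only [unit_mul_mem_highSet])
  obtain ⟨y, hy⟩ := Finset.card_pos.1 hpos
  obtain ⟨z, hz⟩ := Finset.card_pos.1 (hcard ▸ hpos)
  have hw1 := rankWeight_pos hw_pos (le_refl 1) (by norm_num)
  -- The uniform part gives the two sets weights w_1 * A_z and w_1 * A_y, where A_x = ∑ w (x * l)
  -- depends only on the rank. The probe terms add w_1 * A_y on the low set and w_1 * A_z on the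
  -- high set, so both reach w_1 * (A_y + A_z).
  let β : Matrix Cols (Fin 3) F → ℕ := fun l => rankWeight w 1 +
    (if l = probe F (Sum.inl (Sum.inl 0) : Cols) then ∑ l : Matrix Cols (Fin 3) F, w (y * l) else 0) +
    (if l = probe F (Sum.inr 0 : Cols) then ∑ l : Matrix Cols (Fin 3) F, w (z * l) else 0)
  have hβ : ∀ x : Matrix (Fin 3) Cols F, ∑ l, β l * w (x * l) =
      rankWeight w 1 * ∑ l : Matrix Cols (Fin 3) F, w (x * l) +
      (∑ l : Matrix Cols (Fin 3) F, w (y * l)) * w (x * probe F (Sum.inl (Sum.inl 0) : Cols)) +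
      (∑ l : Matrix Cols (Fin 3) F, w (z * l)) * w (x * probe F (Sum.inr 0 : Cols)) := by
    intro x
    simp only [β, add_mul, Finset.sum_add_distrib, ite_mul, zero_mul, Finset.sum_ite_eq',
      Finset.mem_univ, if_true, Finset.mul_sum]
  have key := h.sum_mul_dualCount_sub_eq_zero hw_zero hw_pos β
    (fun l => by simp only [β]; omega) hdisj hcard
    (rankWeight w 1 * (∑ l : Matrix Cols (Fin 3) F, w (y * l) + ∑ l : Matrix Cols (Fin 3) F, w (z * l)))
    (by
      rintro x (hx | hx)
      · rw [hβ, (weight_lowSet hw hw_zero h1 hx).1, (weight_lowSet hw hw_zero h1 hx).2,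
          sum_weight_eq_of_rank_eq hw (x := x) (y := z)]
        · ring
        · rw [rank_of_mem_lowSet h3.le hx, rank_of_mem_lowSet h3.le hz]
      · rw [hβ, (weight_highSet hw hw_zero (by omega) hx).1,
          (weight_highSet hw hw_zero (by omega) hx).2,
          sum_weight_eq_of_rank_eq hw (x := x) (y := y)]
        · ring
        · rw [rank_of_mem_highSet h3 hx, rank_of_mem_highSet h3 hy])
    η η' (fun x => (hη x).symm) (fun x => (hη' x).symm) ht hsingle
  -- Combining the kernel formula with coefficients that produce the indicator of T leaves the sum
  -- of the kernel over T.
  have hswap : ∀ ζ : Matrix Cols (Fin 3) F → ℚ, ∀ T : Finset (Matrix (Fin 3) Cols F),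
      (∀ x, (if x ∈ T then (1 : ℚ) else 0) = ∑ l, ζ l * (w (x * l) : ℚ)) →
      ∑ l, ζ l * ∑ x : Matrix (Fin 3) Cols F, γ x.rank * (w (x * l) : ℚ) = ∑ x ∈ T, γ x.rank := by
    intro ζ T hT
    have e1 : ∀ x, ∑ l, ζ l * (γ x.rank * (w (x * l) : ℚ)) = if x ∈ T then γ x.rank else 0 := by
      intro x
      rw [← mul_boole, hT, Finset.mul_sum]
      exact Finset.sum_congr rfl fun l _ => by ring
    simp only [Finset.mul_sum]
    rw [Finset.sum_comm, Finset.sum_congr rfl fun x _ => e1 x]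
    simp
  simp only [hγ, sub_mul, Finset.sum_sub_distrib] at key
  rw [hswap η _ hη, hswap η' _ hη',
    Finset.sum_congr rfl fun x hx => by rw [rank_of_mem_lowSet h3.le hx],
    Finset.sum_congr (s₁ := highSet F (r + 1)) rfl
      fun x hx => by rw [rank_of_mem_highSet h3 hx],
    Finset.sum_const, Finset.sum_const, hcard, ← smul_sub] at key
  have := (smul_eq_zero.1 key).resolve_left hpos.ne'
  exact sub_eq_zero.1 this

end SwapSets

/-! ### Solving the three rank equations -/

/-- The system of equations that the three values of a weight respecting duality satisfy has only
the constant and the homogeneous solution. -/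
lemma eq_or_eq_of_rank_equations {q C w₁ w₂ w₃ t h₁ h₂ h₃ : ℚ} (hq : 2 ≤ q)
    (hC₁ : C * w₁ = q ^ 3 * (q ^ 2 * h₁ + q * (q + 1) * (q ^ 3 - q) * h₂ +
      (q ^ 3 - q) * (q ^ 3 - q ^ 2) * h₃))
    (hC₂ : C * ((q + 1) * w₁ + (q ^ 3 - q) * w₂) = q ^ 6 * (q * (q + 1) * h₁ +
      (q ^ 2 + q + 1) * (q ^ 3 - q) * h₂ + (q ^ 3 - q) * (q ^ 3 - q ^ 2) * h₃))
    (hC₃ : C * ((q ^ 2 + q + 1) * w₁ + (q ^ 2 + q + 1) * (q ^ 3 - q) * w₂ +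
      (q ^ 3 - q) * (q ^ 3 - q ^ 2) * w₃) = q ^ 9 * ((q ^ 2 + q + 1) * h₁ +
      (q ^ 2 + q + 1) * (q ^ 3 - q) * h₂ + (q ^ 3 - q) * (q ^ 3 - q ^ 2) * h₃))
    (hw : 0 < w₁) (hh₁ : h₁ = 1 ∧ w₁ = t ∨ h₁ = 0 ∧ t < w₁)
    (hh₂ : h₂ = 1 ∧ w₂ = t ∨ h₂ = 0 ∧ t < w₂) (hh₃ : h₃ = 1 ∧ w₃ = t ∨ h₃ = 0 ∧ t < w₃)
    (hne : h₁ ≠ 0 ∨ h₂ ≠ 0 ∨ h₃ ≠ 0) :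
    q * w₂ = (q + 1) * w₁ ∨ w₁ = w₂ ∧ w₂ = w₃ := by
  have hB : 0 < q ^ 3 - q := by
    have : q ^ 3 - q = q * ((q - 1) * (q + 1)) := by ring
    rw [this]
    exact mul_pos (by linarith) (mul_pos (by linarith) (by linarith))
  have hD : 0 < q ^ 3 - q ^ 2 := by
    have : q ^ 3 - q ^ 2 = q ^ 2 * (q - 1) := by ring
    rw [this]
    exact mul_pos (by positivity) (by linarith)
  have hq0 : 0 < q := by linarith
  have e₁ : C * w₁ = q ^ 3 * (q ^ 2 * h₁ + q ^ 2 * (q + 1) * (q ^ 2 - 1) * h₂ +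
      q ^ 3 * (q ^ 2 - 1) * (q - 1) * h₃) := by rw [hC₁]; ring
  have e₂ : C * w₂ = q ^ 3 * ((q ^ 2 + q) * h₁ + q * (q ^ 4 + q ^ 3 - 2 * q - 1) * h₂ +
      q ^ 2 * (q ^ 4 - q ^ 3 - q ^ 2 + 1) * h₃) := by
    apply mul_left_cancel₀ hB.ne'
    linear_combination hC₂ - (q + 1) * e₁
  have e₃ : C * w₃ = q ^ 3 * ((q ^ 2 + q + 1) * h₁ + (q ^ 2 + q + 1) * (q ^ 3 - q - 1) * h₂ +
      (q ^ 6 - q ^ 5 - q ^ 4 + q ^ 2 + q) * h₃) := by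
    apply mul_left_cancel₀ (mul_pos hB hD).ne'
    linear_combination hC₃ - (q ^ 2 + q + 1) * e₁ - (q ^ 2 + q + 1) * (q ^ 3 - q) * e₂
  have hnn : ∀ h w' : ℚ, (h = 1 ∧ w' = t ∨ h = 0 ∧ t < w') → 0 ≤ h := by
    rintro h w' (⟨rfl, -⟩ | ⟨rfl, -⟩) <;> norm_num
  have hC : 0 < C := by
    have h0 : 0 < C * w₁ := by
      rw [hC₁]
      have i₁ := hnn _ _ hh₁
      have i₂ := hnn _ _ hh₂
      have i₃ := hnn _ _ hh₃
      refine mul_pos (by positivity) ?_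
      rcases hne with h | h | h
      · have := lt_of_le_of_ne i₁ h.symm
        positivity
      · have := lt_of_le_of_ne i₂ h.symm
        positivity
      · have := lt_of_le_of_ne i₃ h.symm
        positivity
    exact pos_of_mul_pos_left h0 hw.le
  have hq3 : 0 < q ^ 3 := by positivity
  have lt_iff : ∀ {a b x y : ℚ}, C * a = q ^ 3 * x → C * b = q ^ 3 * y → a < b → x < y := by
    intro a b x y h1 h2 h
    have := mul_lt_mul_of_pos_left h hC
    rw [h1, h2] at this
    exact lt_of_mul_lt_mul_left this hq3.le
  have eq_iff : ∀ {a b x y : ℚ}, C * a = q ^ 3 * x → C * b = q ^ 3 * y → a = b → x = y := by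
    intro a b x y h1 h2 h
    rw [h, h2] at h1
    exact (mul_left_cancel₀ hq3.ne' h1).symm
  -- This is q ^ 3 - q ^ 2 - q, the gap between the right sides of e₁ and e₂ in the patterns (1, 0,
  -- 1) and (0, 1, 0) of (h₁, h₂, h₃).
  have p₁ : 0 < q * (q * (q - 2) + (q - 1)) :=
    mul_pos hq0 (by have := mul_nonneg hq0.le (sub_nonneg.2 hq); linarith)
  rcases hh₁ with ⟨rfl, a₁⟩ | ⟨rfl, a₁⟩ <;> rcases hh₂ with ⟨rfl, a₂⟩ | ⟨rfl, a₂⟩ <;>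
    rcases hh₃ with ⟨rfl, a₃⟩ | ⟨rfl, a₃⟩
  · right; constructor <;> linarith
  · exfalso
    have := eq_iff e₁ e₂ (by linarith)
    linarith
  · exfalso
    have := lt_iff e₁ e₂ (by linarith)
    linarith
  -- Pattern (1, 0, 0): the right sides are in the ratio q : (q + 1), which is the degenerate
  -- solution.
  · left
    apply mul_left_cancel₀ hC.ne'
    linear_combination q * e₂ - (q + 1) * e₁
  · exfalso
    have := eq_iff e₂ e₃ (by linarith)
    linarith
  · exfalso
    have := lt_iff e₂ e₁ (by linarith)
    linarith
  · exfalso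
    have := lt_iff e₃ e₂ (by linarith)
    linarith
  · simp at hne

/-! ### Dual counts and total weights of a block of given rank -/

section DualCounts

variable {F : Type*} [Field F]

/-- The `3 × a` matrix whose columns are the standard vectors from the position `s` on. -/
def colSkip (F : Type*) [Field F] (s a : ℕ) : Matrix (Fin 3) (Fin a) F :=
  Matrix.of fun i k => if (i : ℕ) = k + s then 1 else 0

lemma colSkip_transpose_mul_colSkip {s a : ℕ} (h : s + a = 3) :
    (colSkip F s a)ᵀ * colSkip F s a = 1 := by
  ext i j
  rw [mul_apply, Finset.sum_eq_single ⟨i + s, by omega⟩]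
  · simp [colSkip, one_apply, Fin.ext_iff]
  · intro b _ hb
    simp only [colSkip, transpose_apply, of_apply]
    rw [if_neg, zero_mul]
    intro h; apply hb; ext; exact h
  · simp

lemma colSkip_transpose_mul_colIncl (s a : ℕ) : (colSkip F s a)ᵀ * colIncl F 3 s = 0 := by
  ext i j
  rw [mul_apply]
  refine Finset.sum_eq_zero fun b _ => ?_
  simp only [colSkip, colIncl, transpose_apply, of_apply]
  split_ifs <;> simp
  omega

lemma colSkip_mul_add_colIncl_mul {s a : ℕ} (h : s + a = 3) :
    colSkip F s a * (colSkip F s a)ᵀ + colIncl F 3 s * (colIncl F 3 s)ᵀ = 1 := by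
  obtain ⟨rfl⟩ : a = 3 - s := by omega
  have hs : s ≤ 3 := by omega
  interval_cases s <;> ext i j <;> fin_cases i <;> fin_cases j <;>
    simp [colSkip, colIncl, mul_apply, Fin.sum_univ_succ, one_apply]

variable [Fintype F] {w : Matrix (Fin 3) (Fin 3) F → ℕ}

/-- The number of words of weight `t` in the kernel of a matrix of rank `s = 3 - a`. -/
lemma dualCount_eq_sum_rankCount (hw : MaximalSymmetry w) (t : ℕ) {s a : ℕ} (h : s + a = 3)
    {ι : Type*} [Fintype ι] [DecidableEq ι] {Q : Matrix ι (Fin s) F} {B : Matrix (Fin s) ι F}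
    (hBQ : B * Q = 1) :
    (dualCount w t (Q * (colIncl F 3 s)ᵀ) : ℚ) =
      ∑ i ∈ Finset.range (a + 1), rankCount F a i * if rankWeight w i = t then 1 else 0 := by
  classical
  rw [← sum_rank F a fun i => if rankWeight w i = t then (1 : ℚ) else 0, Finset.sum_boole, dualCount,
    Nat.cast_inj, ← Fintype.card_subtype, ← Nat.card_eq_fintype_card]
  symm
  have hrank : ∀ z : Matrix (Fin 3) (Fin a) F, ((z * (colSkip F s a)ᵀ)ᵀ).rank = z.rank := by
    intro z
    rw [rank_transpose, rank_mul_eq_left_of_mul_eq_one _ (colSkip_transpose_mul_colSkip h)]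
  have hmem : ∀ r : Matrix (Fin 3) (Fin 3) F, Q * (colIncl F 3 s)ᵀ * r = 0 ↔
      rᵀ * colIncl F 3 s = 0 := by
    intro r
    rw [← transpose_eq_zero (M := rᵀ * colIncl F 3 s), transpose_mul, transpose_transpose]
    constructor
    · intro h0
      have := congrArg (fun z => B * z) h0
      simpa [← Matrix.mul_assoc, hBQ] using this
    · intro h0
      rw [Matrix.mul_assoc, h0, Matrix.mul_zero]
  -- As Q is left invertible, r is killed exactly when its first s rows vanish. The remaining a
  -- rows, transposed, form a 3 × a matrix of the same rank.
  refine Nat.card_congr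
    { toFun := fun z => ⟨(z.1 * (colSkip F s a)ᵀ)ᵀ, ?_, ?_⟩
      invFun := fun r => ⟨r.1ᵀ * colSkip F s a, ?_⟩
      left_inv := ?_
      right_inv := ?_ }
  · rw [hw.eq_rankWeight, hrank]; exact z.2
  · rw [hmem, transpose_transpose, Matrix.mul_assoc, colSkip_transpose_mul_colIncl,
      Matrix.mul_zero]
  · have h1 : (r.1ᵀ * colSkip F s a * (colSkip F s a)ᵀ)ᵀ = r.1 := by
      have h2 := (hmem r.1).1 r.2.2
      have h3 : r.1ᵀ * (colSkip F s a * (colSkip F s a)ᵀ + colIncl F 3 s * (colIncl F 3 s)ᵀ) =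
          r.1ᵀ := by rw [colSkip_mul_add_colIncl_mul h, Matrix.mul_one]
      rw [Matrix.mul_add, ← Matrix.mul_assoc, ← Matrix.mul_assoc, h2, Matrix.zero_mul,
        add_zero] at h3
      rw [h3, transpose_transpose]
    rw [← hrank, h1, ← hw.eq_rankWeight]; exact r.2.1
  · intro z
    ext1
    simp [Matrix.mul_assoc, colSkip_transpose_mul_colSkip h]
  · intro r
    ext1
    have h2 := (hmem r.1).1 r.2.2
    have h3 : r.1ᵀ * (colSkip F s a * (colSkip F s a)ᵀ + colIncl F 3 s * (colIncl F 3 s)ᵀ) =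
        r.1ᵀ := by rw [colSkip_mul_add_colIncl_mul h, Matrix.mul_one]
    rw [Matrix.mul_add, ← Matrix.mul_assoc, ← Matrix.mul_assoc, h2, Matrix.zero_mul,
      add_zero] at h3
    simp only [h3, transpose_transpose]

lemma dualCount_zero (hw : MaximalSymmetry w) (t : ℕ) {ι : Type*} [Fintype ι] [DecidableEq ι] :
    (dualCount w t (0 : Matrix ι (Fin 3) F) : ℚ) =
      ∑ i ∈ Finset.range 4, rankCount F 3 i * if rankWeight w i = t then 1 else 0 := by
  rw [← dualCount_eq_sum_rankCount hw t (s := 0) (a := 3) rfl (Q := (0 : Matrix ι (Fin 0) F))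
    (B := 0) (Subsingleton.elim _ _), Matrix.zero_mul]

/-- The map x ↦ x * Q is a surjective homomorphism onto the 3 × s matrices, hence has fibres of
constant size, and the factor `(colIncl F 3 s)ᵀ` preserves rank. -/
lemma sum_weight_mul_eq (hw : MaximalSymmetry w) {s : ℕ} (hs : s ≤ 3)
    {ι : Type*} [Fintype ι] [DecidableEq ι] {Q : Matrix ι (Fin s) F} {B : Matrix (Fin s) ι F}
    (hBQ : B * Q = 1) :
    (Fintype.card F : ℚ) ^ (3 * s) *
      ∑ x : Matrix (Fin 3) ι F, (w (x * (Q * (colIncl F 3 s)ᵀ)) : ℚ) =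
    Fintype.card (Matrix (Fin 3) ι F) *
      ∑ i ∈ Finset.range (s + 1), rankCount F s i * (rankWeight w i : ℚ) := by
  let φ : Matrix (Fin 3) ι F →+ Matrix (Fin 3) (Fin s) F :=
    { toFun := fun x => x * Q
      map_zero' := by simp
      map_add' := fun _ _ => Matrix.add_mul _ _ _ }
  have hφ : Function.Surjective φ := fun z => ⟨z * B, by
    change z * B * Q = z
    rw [Matrix.mul_assoc, hBQ, Matrix.mul_one]⟩
  have h1 := card_mul_sum_comp_of_surjective φ hφ fun z => (rankWeight w z.rank : ℚ)
  rw [card_matrix, sum_rank F s fun i => (rankWeight w i : ℚ)] at h1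
  rw [← h1]
  push_cast
  congr 1
  refine Finset.sum_congr rfl fun x _ => ?_
  rw [hw.eq_rankWeight, ← Matrix.mul_assoc,
    rank_mul_eq_left_of_mul_eq_one _ (colIncl_transpose_mul_colIncl hs)]
  rfl

end DualCounts

/-! ### The nondegenerate case -/

section Nondegenerate

variable {F : Type*} [Field F] [Fintype F] {w : Matrix (Fin 3) (Fin 3) F → ℕ}

lemma exists_rank_eq_of_ne_zero (hw : MaximalSymmetry w) {r : Matrix (Fin 3) (Fin 3) F}
    (hr : r ≠ 0) : w r = rankWeight w 1 ∨ w r = rankWeight w 2 ∨ w r = rankWeight w 3 := by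
  rw [hw.eq_rankWeight]
  have h3 : r.rank ≤ 3 := r.rank_le_width
  have h0 : r.rank ≠ 0 := fun h => hr ((rank_eq_zero_iff r).1 h)
  generalize r.rank = k at h3 h0
  interval_cases k <;> simp_all

lemma isMultipleOfHamming_of_eq (hw : MaximalSymmetry w) (hw_zero : w 0 = 0)
    (h12 : rankWeight w 1 = rankWeight w 2) (h23 : rankWeight w 2 = rankWeight w 3) :
    IsMultipleOfHamming w := by
  refine ⟨rankWeight w 1, fun r => ?_⟩
  rw [hammingWeight]
  split_ifs with hr
  · rw [hr, hw_zero, mul_zero]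
  · rcases exists_rank_eq_of_ne_zero hw hr with h | h | h <;> omega

/-- A nondegenerate weight that respects duality is a multiple of the Hamming weight. -/
theorem RespectsDuality.isMultipleOfHamming (h : RespectsDuality w) (hw : MaximalSymmetry w)
    (hw_zero : w 0 = 0) (hw_pos : ∀ r, r ≠ 0 → 0 < w r) (hnd : Nondegenerate w) :
    IsMultipleOfHamming w := by
  have hw1 := rankWeight_pos hw_pos (le_refl 1) (by norm_num)
  have hw2 := rankWeight_pos hw_pos (i := 2) (by norm_num) (by norm_num)
  have hw3 := rankWeight_pos hw_pos (i := 3) (by norm_num) (by norm_num)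
  -- The least nonzero weight is below the sum of any two nonzero weights, so its dual words have
  -- one nonzero entry.
  obtain ⟨t, ht1, ht2, ht3, htm⟩ : ∃ t, t ≤ rankWeight w 1 ∧ t ≤ rankWeight w 2 ∧
      t ≤ rankWeight w 3 ∧ (rankWeight w 1 = t ∨ rankWeight w 2 = t ∨ rankWeight w 3 = t) :=
    ⟨min (rankWeight w 1) (min (rankWeight w 2) (rankWeight w 3)), by omega, by omega, by omega,
      by omega⟩
  have ht : 0 < t := by omega
  have hsingle : ∀ r s : Matrix (Fin 3) (Fin 3) F, r ≠ 0 → s ≠ 0 → t < w r + w s := by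
    intro r s hr hs
    have := exists_rank_eq_of_ne_zero hw hr
    have := exists_rank_eq_of_ne_zero hw hs
    omega
  obtain ⟨γ, hγ⟩ := h.exists_rank_kernel (ι := Cols) hw hw_zero hw_pos ht hsingle
  have hγ12 := h.kernel_succ hw hw_zero hw_pos hnd ht hsingle γ hγ (le_refl 1) (by norm_num)
  have hγ23 := h.kernel_succ hw hw_zero hw_pos hnd ht hsingle γ hγ (r := 2) (by norm_num)
    (by norm_num)
  have hconst : ∀ l : Matrix Cols (Fin 3) F,
      (dualCount w t l : ℚ) - dualCount w t (0 : Matrix Cols (Fin 3) F) =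
        γ 1 * ∑ x : Matrix (Fin 3) Cols F, (w (x * l) : ℚ) := by
    intro l
    rw [hγ, Finset.mul_sum]
    refine Finset.sum_congr rfl fun x _ => ?_
    have h3 : x.rank ≤ 3 := by simpa using x.rank_le_card_height
    by_cases h0 : x.rank = 0
    · rw [(rank_eq_zero_iff x).1 h0]; simp [hw_zero]
    · congr 1
      generalize x.rank = k at h3 h0
      rcases (by omega : k = 1 ∨ k = 2 ∨ k = 3) with rfl | rfl | rfl
      · rfl
      · exact hγ12.symm
      · exact hγ23.symm.trans hγ12.symm
  set H : ℕ → ℚ := fun i => if rankWeight w i = t then 1 else 0 with hH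
  have hH0 : H 0 = 0 := by
    simp only [hH, rankWeight_zero hw_zero]
    exact if_neg ht.ne
  set N : ℚ := (Fintype.card (Matrix (Fin 3) Cols F) : ℚ)
  have heq : ∀ s a : ℕ, s + a = 3 → (Fintype.card F : ℚ) ^ (3 * s) *
      (∑ i ∈ Finset.range (a + 1), rankCount F a i * H i -
        ∑ i ∈ Finset.range 4, rankCount F 3 i * H i) =
      γ 1 * N * ∑ i ∈ Finset.range (s + 1), rankCount F s i * (rankWeight w i : ℚ) := by
    intro s a hsa
    have hs : s ≤ 3 := by omega
    have e1 := hconst ((fromRows 0 (colIncl F 3 s) : Matrix Cols (Fin s) F) * (colIncl F 3 s)ᵀ)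
    rw [dualCount_eq_sum_rankCount hw t hsa (highBasis_mul hs), dualCount_zero hw t] at e1
    rw [e1, mul_left_comm, sum_weight_mul_eq hw hs (highBasis_mul hs)]
    ring
  have hq := card_rat_ge_two (F := F)
  have q1 := heq 1 2 rfl
  have q2 := heq 2 1 rfl
  have q3 := heq 3 0 rfl
  simp only [Finset.sum_range_succ, Finset.sum_range_zero, rankCount_zero, hH0,
    rankWeight_zero hw_zero, rankCount_one_one, rankCount_two_one, rankCount_two_two,
    rankCount_three_one, rankCount_three_two, rankCount_three_three, Nat.cast_zero,
    mul_zero, zero_add] at q1 q2 q3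
  have hA : (Fintype.card F : ℚ) ^ 3 - 1 ≠ 0 := by
    have := one_lt_pow₀ (by linarith : (1 : ℚ) < Fintype.card F) (by norm_num : 3 ≠ 0)
    linarith
  have hval : ∀ i, t ≤ rankWeight w i → H i = 1 ∧ (rankWeight w i : ℚ) = t ∨
      H i = 0 ∧ (t : ℚ) < rankWeight w i := by
    intro i hi
    simp only [hH]
    split_ifs with h1
    · left; exact ⟨rfl, by exact_mod_cast h1⟩
    · right; exact ⟨rfl, by exact_mod_cast lt_of_le_of_ne hi (Ne.symm h1)⟩
  -- The sign is reversed because a block of positive rank kills fewer matrices than the zero block.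
  -- The common factor q ^ 3 - 1 is cancelled in each equation.
  have hsol := eq_or_eq_of_rank_equations (q := Fintype.card F) (C := -(γ 1 * N))
    (w₁ := rankWeight w 1) (w₂ := rankWeight w 2) (w₃ := rankWeight w 3) (t := t)
    (h₁ := H 1) (h₂ := H 2) (h₃ := H 3) hq
    (by apply mul_left_cancel₀ hA; linear_combination q1)
    (by apply mul_left_cancel₀ hA; linear_combination q2)
    (by apply mul_left_cancel₀ hA; linear_combination q3)
    (by exact_mod_cast hw1) (hval 1 ht1) (hval 2 ht2) (hval 3 ht3)
    (by rcases htm with h | h | h <;> simp [hH, h])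
  rcases hsol with hsol | ⟨h12, h23⟩
  · exfalso
    apply hnd 2 (by norm_num) (by norm_num)
    rw [degeneracyCoeff_two hw_zero]
    linear_combination (Fintype.card F : ℚ) * hsol
  · exact isMultipleOfHamming_of_eq hw hw_zero (by exact_mod_cast h12) (by exact_mod_cast h23)

end Nondegenerate

/-! ### The degenerate case: points of a projective line against full blocks -/

section Degenerate

variable {F : Type*} [Field F] {w : Matrix (Fin 3) (Fin 3) F → ℕ}

/-- Representatives of the points of the projective line over `F`. -/
def linePoint : Option F → Matrix (Fin 2) (Fin 1) F
  | some c => !![1; c]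
  | none => !![0; 1]

lemma exists_mul_linePoint_eq_one (p : Option F) :
    ∃ B : Matrix (Fin 1) (Fin 2) F, B * linePoint p = 1 := by
  cases p with
  | some c => exact ⟨!![1, 0], by ext i j; fin_cases i; fin_cases j; simp [linePoint, mul_apply]⟩
  | none => exact ⟨!![0, 1], by ext i j; fin_cases i; fin_cases j; simp [linePoint, mul_apply]⟩

lemma mul_linePoint_some (x : Matrix (Fin 3) (Fin 2) F) (c : F) :
    x * linePoint (some c) = 0 ↔ ∀ k, x k 0 + x k 1 * c = 0 := by
  constructor
  · intro h k
    simpa [linePoint, mul_apply, Fin.sum_univ_two] using congrFun (congrFun h k) 0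
  · intro h
    ext k j
    fin_cases j
    simpa [linePoint, mul_apply, Fin.sum_univ_two] using h k

lemma mul_linePoint_none (x : Matrix (Fin 3) (Fin 2) F) :
    x * linePoint (none : Option F) = 0 ↔ ∀ k, x k 1 = 0 := by
  constructor
  · intro h k
    simpa [linePoint, mul_apply, Fin.sum_univ_two] using congrFun (congrFun h k) 0
  · intro h
    ext k j
    fin_cases j
    simpa [linePoint, mul_apply, Fin.sum_univ_two] using h k

/-- A matrix of rank one with two columns kills exactly one point of the projective line. -/
lemma existsUnique_linePoint {x : Matrix (Fin 3) (Fin 2) F} (hx : x.rank = 1) :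
    ∃ p : Option F, x * linePoint p = 0 ∧ ∀ p', x * linePoint p' = 0 → p' = p := by
  have hx0 : ¬ ∀ k, x k 0 = 0 ∧ x k 1 = 0 := by
    intro h
    have : x = 0 := by
      ext k j
      fin_cases j
      · exact (h k).1
      · exact (h k).2
    rw [this, rank_zero] at hx
    omega
  have hinj : ¬ ∀ v, x *ᵥ v = 0 → v = 0 := by
    rw [mulVec_injective_iff_rank_eq, hx]; simp
  push Not at hinj
  obtain ⟨u, hu, hu0⟩ := hinj
  have hu' : ∀ k, x k 0 * u 0 + x k 1 * u 1 = 0 := by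
    intro k
    have := congrFun hu k
    simpa [mulVec, dotProduct, Fin.sum_univ_two] using this
  by_cases h0 : u 0 = 0
  · have h1 : u 1 ≠ 0 := by
      intro h1
      apply hu0
      ext j
      fin_cases j
      · exact h0
      · exact h1
    have hx1 : ∀ k, x k 1 = 0 := fun k => by
      have := hu' k
      rw [h0, mul_zero, zero_add] at this
      exact (mul_eq_zero.1 this).resolve_right h1
    refine ⟨none, (mul_linePoint_none x).2 hx1, fun p' hp' => ?_⟩
    cases p' with
    | none => rfl
    | some c =>
      exfalso
      apply hx0
      intro k
      have := (mul_linePoint_some x c).1 hp' k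
      rw [hx1, zero_mul, add_zero] at this
      exact ⟨this, hx1 k⟩
  · have hc : ∀ k, x k 0 + x k 1 * (u 1 / u 0) = 0 := by
      intro k
      have := hu' k
      field_simp
      linear_combination this
    refine ⟨some (u 1 / u 0), (mul_linePoint_some x _).2 hc, fun p' hp' => ?_⟩
    cases p' with
    | none =>
      exfalso
      apply hx0
      intro k
      have h1 := (mul_linePoint_none x).1 hp' k
      have := hc k
      rw [h1, zero_mul, add_zero] at this
      exact ⟨this, h1⟩
    | some c =>
      by_contra hne
      apply hx0
      intro k
      have h1 := (mul_linePoint_some x c).1 hp' k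
      have h2 := hc k
      have h3 : x k 1 * (c - u 1 / u 0) = 0 := by linear_combination h1 - h2
      have h4 := (mul_eq_zero.1 h3).resolve_right
        (sub_ne_zero.2 fun h => hne (by rw [h]))
      rw [h4, zero_mul, add_zero] at h2
      exact ⟨h2, h4⟩

variable [Fintype F]

lemma weight_mul_linePoint (hw : MaximalSymmetry w) (hw_zero : w 0 = 0)
    [DecidableEq (Matrix (Fin 3) (Fin 1) F)]
    (x : Matrix (Fin 3) (Fin 2) F) (p : Option F) :
    w (x * (linePoint p * (colIncl F 3 1)ᵀ)) =
      if x * linePoint p = 0 then 0 else rankWeight w 1 := by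
  split_ifs with h
  · rw [← Matrix.mul_assoc, h, Matrix.zero_mul, hw_zero]
  · rw [← Matrix.mul_assoc, hw.eq_rankWeight,
      rank_mul_eq_left_of_mul_eq_one _ (colIncl_transpose_mul_colIncl (by norm_num))]
    congr 1
    have h1 : (x * linePoint p).rank ≤ 1 := rank_le_width _
    have h0 : (x * linePoint p).rank ≠ 0 := fun h0 => h ((rank_eq_zero_iff _).1 h0)
    omega

/-- A matrix of rank 1 kills exactly one of the q + 1 points and gets weight q * w_1. One of rank 2
kills none and gets (q + 1) * w_1, which degeneracy turns into q * w_2. -/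
lemma sum_weight_mul_linePoint (hw : MaximalSymmetry w) (hw_zero : w 0 = 0)
    (hdeg : Fintype.card F * rankWeight w 2 = (Fintype.card F + 1) * rankWeight w 1)
    (x : Matrix (Fin 3) (Fin 2) F) :
    ∑ p : Option F, w (x * (linePoint p * (colIncl F 3 1)ᵀ)) =
      Fintype.card F * rankWeight w x.rank := by
  classical
  simp only [weight_mul_linePoint hw hw_zero]
  have h2 : x.rank ≤ 2 := x.rank_le_width
  rcases (by omega : x.rank = 0 ∨ x.rank = 1 ∨ x.rank = 2) with h | h | h
  · rw [h, rankWeight_zero hw_zero, (rank_eq_zero_iff x).1 h]; simp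
  · obtain ⟨p, hp, hp'⟩ := existsUnique_linePoint h
    have : ∀ p' : Option F, (x * linePoint p' = 0) ↔ p' = p := fun p' => ⟨hp' p', fun h => h ▸ hp⟩
    simp only [this, h]
    rw [← Finset.sum_erase_add _ _ (Finset.mem_univ p), if_pos rfl, add_zero,
      Finset.sum_congr rfl fun p' hp' => if_neg (Finset.ne_of_mem_erase hp'), Finset.sum_const,
      Finset.card_erase_of_mem (Finset.mem_univ p)]
    simp
  · have : ∀ p : Option F, ¬ (x * linePoint p = 0) := by
      intro p hp
      have h0 := mul_left_cancel_of_rank_eq h (hp.trans (Matrix.mul_zero x).symm)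
      obtain ⟨B, hB⟩ := exists_mul_linePoint_eq_one p
      rw [h0, Matrix.mul_zero] at hB
      exact zero_ne_one hB
    simp [this, h, hdeg]

/-- A weight with `q * w₂ = (q + 1) * w₁` does not respect duality. -/
theorem not_respectsDuality_of_degenerate (hw : MaximalSymmetry w)
    (hw_zero : w 0 = 0) (hw_pos : ∀ r, r ≠ 0 → 0 < w r)
    (hdeg : Fintype.card F * rankWeight w 2 = (Fintype.card F + 1) * rankWeight w 1) :
    ¬ RespectsDuality w := by
  intro h
  have hw1 := rankWeight_pos hw_pos (le_refl 1) (by norm_num)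
  have hw3 := rankWeight_pos hw_pos (i := 3) (by norm_num) (by norm_num)
  have hcard := two_le_card (F := F)
  have h12 : rankWeight w 1 < rankWeight w 2 := by
    by_contra hc
    have := Nat.mul_le_mul_left (Fintype.card F) (not_lt.1 hc)
    rw [hdeg, add_mul, one_mul] at this
    omega
  have h21 : rankWeight w 2 < 2 * rankWeight w 1 := by
    by_contra hc
    have := Nat.mul_le_mul_left (Fintype.card F) (not_lt.1 hc)
    rw [hdeg] at this
    nlinarith
  -- Degeneracy gives w_1 < w_2 < 2 * w_1. Hence w_3 is a suitable value if w_3 < w_1, and w_2 is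
  -- one otherwise; both differ from w_1, so matrices of rank 1 do not contribute.
  obtain ⟨t, ht, hlt, h1t, h23t⟩ : ∃ t, 0 < t ∧
      (t < 2 * rankWeight w 1 ∧ t < 2 * rankWeight w 3 ∧ t < rankWeight w 1 + rankWeight w 3) ∧
      rankWeight w 1 ≠ t ∧ (rankWeight w 2 = t ∨ rankWeight w 3 = t) := by
    rcases lt_or_ge (rankWeight w 3) (rankWeight w 1) with h3 | h3
    · exact ⟨rankWeight w 3, by omega, by omega, by omega, Or.inr rfl⟩
    · exact ⟨rankWeight w 2, by omega, by omega, by omega, Or.inl rfl⟩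
  have hsingle : ∀ r s : Matrix (Fin 3) (Fin 3) F, r ≠ 0 → s ≠ 0 → t < w r + w s := by
    intro r s hr hs
    have := exists_rank_eq_of_ne_zero hw hr
    have := exists_rank_eq_of_ne_zero hw hs
    omega
  -- A zero block at `none` and a block of rank 2 at each of the q other indices: the length is
  -- again q + 1.
  let lam' : Option F → Matrix (Fin 2) (Fin 3) F := fun p =>
    p.elim 0 fun _ => (1 : Matrix (Fin 2) (Fin 2) F) * (colIncl F 3 2)ᵀ
  have hwt := sum_weight_mul_linePoint hw hw_zero hdeg
  have hwt' : ∀ x : Matrix (Fin 3) (Fin 2) F,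
      ∑ p, w (x * lam' p) = Fintype.card F * rankWeight w x.rank := by
    intro x
    rw [Fintype.sum_option]
    simp only [lam', Option.elim_none, Option.elim_some, Matrix.mul_zero, hw_zero, zero_add,
      Matrix.one_mul]
    rw [Finset.sum_const, Finset.card_univ, hw.eq_rankWeight,
      rank_mul_eq_left_of_mul_eq_one _ (colIncl_transpose_mul_colIncl (by norm_num)), smul_eq_mul]
  have hpos : ∀ x : Matrix (Fin 3) (Fin 2) F, x ≠ 0 → 0 < Fintype.card F * rankWeight w x.rank := by
    intro x hx
    have h0 : x.rank ≠ 0 := fun h0 => hx ((rank_eq_zero_iff x).1 h0)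
    have h2 : x.rank ≤ 2 := x.rank_le_width
    exact Nat.mul_pos (by omega) (rankWeight_pos hw_pos (by omega) (by omega))
  have key := h.sum_dualCount_eq hw_zero rfl (fun p : Option F => linePoint p * (colIncl F 3 1)ᵀ)
    lam' (fun x hx => by rw [hwt]; exact hpos x hx) (fun x hx => by rw [hwt']; exact hpos x hx)
    (fun φ => by simp only [hwt, hwt']) ht hsingle
  have key' : ∑ p : Option F, (dualCount w t (linePoint p * (colIncl F 3 1)ᵀ) : ℚ) =
      ∑ p, (dualCount w t (lam' p) : ℚ) := by exact_mod_cast key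
  have e1 : ∀ p : Option F, (dualCount w t (linePoint p * (colIncl F 3 1)ᵀ) : ℚ) =
      ∑ i ∈ Finset.range 3, rankCount F 2 i * if rankWeight w i = t then 1 else 0 := by
    intro p
    obtain ⟨B, hB⟩ := exists_mul_linePoint_eq_one p
    exact dualCount_eq_sum_rankCount hw t rfl hB
  have e2 : (dualCount w t ((1 : Matrix (Fin 2) (Fin 2) F) * (colIncl F 3 2)ᵀ) : ℚ) =
      ∑ i ∈ Finset.range 2, rankCount F 1 i * if rankWeight w i = t then 1 else 0 :=
    dualCount_eq_sum_rankCount hw t rfl (Matrix.one_mul (1 : Matrix (Fin 2) (Fin 2) F))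
  rw [Finset.sum_congr rfl fun p _ => e1 p, Fintype.sum_option] at key'
  simp only [Fintype.sum_option, lam', Option.elim_none, Option.elim_some, e2,
    dualCount_zero hw] at key'
  have h0t : rankWeight w 0 ≠ t := by rw [rankWeight_zero hw_zero]; exact ht.ne
  simp only [Finset.sum_const, Finset.card_univ, nsmul_eq_mul, Finset.sum_range_succ,
    Finset.sum_range_zero, if_neg h0t, if_neg h1t, rankCount_two_two, rankCount_three_two,
    rankCount_three_three, mul_zero, zero_add, add_zero] at key'
  have hq := card_rat_ge_two (F := F)
  set q : ℚ := (Fintype.card F : ℚ)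
  have hA : 0 < q ^ 3 - 1 := by
    have := one_lt_pow₀ (by linarith : 1 < q) (by norm_num : 3 ≠ 0)
    linarith
  have hB : 0 < q ^ 3 - q := by
    have : q ^ 3 - q = q * ((q - 1) * (q + 1)) := by ring
    rw [this]
    exact mul_pos (by linarith) (mul_pos (by linarith) (by linarith))
  have hD : 0 < q ^ 3 - q ^ 2 := by
    have : q ^ 3 - q ^ 2 = q ^ 2 * (q - 1) := by ring
    rw [this]
    exact mul_pos (by positivity) (by linarith)
  -- The difference of the two counts after division by (q ^ 3 - 1) * (q ^ 3 - q). In the second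
  -- family only the zero block has dual words of weight t. Both coefficients are positive and one
  -- of the indicators is 1, which is impossible.
  have hkey : q ^ 2 * (if rankWeight w 2 = t then 1 else 0) +
      (q ^ 3 - q ^ 2) * (if rankWeight w 3 = t then 1 else 0) = 0 := by
    apply mul_left_cancel₀ (mul_pos hA hB).ne'
    linear_combination -key'
  have hq2 : 0 < q ^ 2 := by positivity
  rcases h23t with h2 | h3
  · rw [if_pos h2] at hkey
    split_ifs at hkey <;> linarith
  · rw [if_pos h3] at hkey
    split_ifs at hkey <;> linarith

end Degenerate

end WeightDuality

theorem mainTheorem10 {F : Type*} [Field F] [Fintype F]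
    (w : Matrix (Fin 3) (Fin 3) F → ℕ)
    (hw_zero : w 0 = 0) (hw_pos : ∀ r, r ≠ 0 → 0 < w r)
    (hw_sym : WeightDuality.MaximalSymmetry w) :
    (WeightDuality.Nondegenerate w → ¬ WeightDuality.IsMultipleOfHamming w →
      ¬ WeightDuality.RespectsDuality w) ∧
    (-((Fintype.card F : ℤ) + 1) * (WeightDuality.rankWeight w 1 : ℤ) +
        (Fintype.card F : ℤ) * (WeightDuality.rankWeight w 2 : ℤ) = 0 →
      ¬ WeightDuality.RespectsDuality w) := by
  refine ⟨fun hnd hH h => hH (h.isMultipleOfHamming hw_sym hw_zero hw_pos hnd), fun hdeg =>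
    WeightDuality.not_respectsDuality_of_degenerate hw_sym hw_zero hw_pos ?_⟩
  have h : (Fintype.card F : ℤ) * WeightDuality.rankWeight w 2 =
      ((Fintype.card F : ℤ) + 1) * WeightDuality.rankWeight w 1 := by linear_combination hdeg
  exact_mod_cast h
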